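/- Consider the square lattice $\mathbb Z^2=\mathbb Z+i\mathbb Z\subset\mathbb C$ with mesh size $1$ and edges between nearest neighbours. For a box $\Lambda_N=[-N,N]^2\cap\mathbb Z^2$, with the lattice edges between its sites, let $\partial\Lambda_N$ be the set of sites of $\Lambda_N$ with fewer than four neighbours in $\Lambda_N$. For a partition $\psi$ of $\partial\Lambda_N$ (a boundary condition) and $p\in[0,1]$, the FK-Ising measure $\phi^{\psi}_{p,\Lambda_N}$ gives to each set $\omega$ of open edges of $\Lambda_N$ a probability proportional to $$p^{o(\omega)}(1-p)^{c(\omega)}\,2^{k(\omega,\psi)},$$ where $o(\omega)$ and $c(\omega)$ are the numbers of open and closed edges and $k(\omega,\psi)$ is the number of connected components of the graph obtained from $(\Lambda_N,\omega)$ by identifying the boundary sites in the same class of $\psi$. An infinite-volume FK-Ising measure with parameter $p$ is a probability measure $\phi_p$ on $\{\text{open},\text{closed}\}^{E(\mathbb Z^2)}$ such that, for some $N_1<N_2<\cdots$ and some boundary conditions $\psi_k$ on $\Lambda_{N_k}$, $\phi^{\psi_k}_{p,\Lambda_{N_k}}(A)\to\phi_p(A)$ as $k\to\infty$ for every event $A$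 depending on finitely many edges. Write $x\leftrightarrow y$ if $x$ and $y$ are joined by a path of open edges. **Proposition.** Let $0\le p<\sqrt2/(1+\sqrt2)$. There exists $\xi=\xi(p)>0$ such that, for every infinite-volume FK-Ising measure $\phi_p$ with parameter $p$ and every integer $n\ge0$, $$\phi_p(0\leftrightarrow in)\le e^{-\xi n}.$$ -/

import Mathlib

open MeasureTheory Filter Topology

noncomputable section

namespace FK

/-- The square lattice `ℤ² = ℤ + iℤ ⊂ ℂ` of mesh size one; the pair `(a, b)` is the site `a + ib`. -/
def squareLattice : SimpleGraph (ℤ × ℤ) where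
  Adj x y := |x.1 - y.1| + |x.2 - y.2| = 1
  symm := ⟨fun x y h => by rw [abs_sub_comm y.1, abs_sub_comm y.2]; exact h⟩
  loopless := ⟨fun x h => by simp at h⟩

/-- Percolation configurations on the whole lattice: `ω e = true` means that `e` is open. They
carry the product σ-algebra, generated by the events that depend on finitely many edges. -/
abbrev Config : Type := squareLattice.edgeSet → Bool

/-- The subgraph of the lattice formed by all sites and the open edges of `ω`. -/
def openGraph (ω : Config) : SimpleGraph (ℤ × ℤ) :=
  SimpleGraph.fromEdgeSet {e | ∃ h : e ∈ squareLattice.edgeSet, ω ⟨e, h⟩ = true}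

/-- `x ↔ y`: there is a path of open edges from `x` to `y`. -/
def Connected (ω : Config) (x y : ℤ × ℤ) : Prop :=
  (openGraph ω).Reachable x y

/-- The box `[-N, N]²`. -/
def box (N : ℕ) : Finset (ℤ × ℤ) :=
  Finset.Icc (-(N : ℤ)) N ×ˢ Finset.Icc (-(N : ℤ)) N

open Classical in
/-- The edges of the lattice with both endpoints in `Λ`. -/
def edgesIn (Λ : Finset (ℤ × ℤ)) : Finset squareLattice.edgeSet :=
  Λ.sym2.subtype (· ∈ squareLattice.edgeSet)

open Classical in
/-- The sites of `Λ` with fewer than four neighbours in `Λ`. -/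
def boundary (Λ : Finset (ℤ × ℤ)) : Finset (ℤ × ℤ) :=
  Λ.filter fun x => (Λ.filter fun y => squareLattice.Adj x y).card < 4

/-- A boundary condition on `Λ` is a partition of the boundary of `Λ`, given as an equivalence
relation; `⊥` is the free and `⊤` the wired boundary condition. -/
abbrev BoundaryCondition (Λ : Finset (ℤ × ℤ)) : Type := Setoid (boundary Λ)

open Classical in
/-- The configuration whose open edges are exactly those of `S`. -/
def ofOpenEdges (S : Finset squareLattice.edgeSet) : Config := fun e => decide (e ∈ S)

/-- The graph with vertex set `Λ` whose edges are the open edges `S` inside `Λ`, together with an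
edge between any two distinct boundary sites in the same class of `ξ`. Its connected components are
those of the graph obtained by identifying the boundary sites of each class. -/
def wiredGraph (Λ : Finset (ℤ × ℤ)) (ξ : BoundaryCondition Λ) (S : Finset squareLattice.edgeSet) :
    SimpleGraph Λ :=
  (openGraph (ofOpenEdges S)).comap Subtype.val ⊔
    SimpleGraph.fromRel fun x y : Λ =>
      ∃ (hx : x.1 ∈ boundary Λ) (hy : y.1 ∈ boundary Λ), ξ ⟨x.1, hx⟩ ⟨y.1, hy⟩

/-- The number `k(ω, ξ)` of clusters. -/
def numClusters (Λ : Finset (ℤ × ℤ)) (ξ : BoundaryCondition Λ)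
    (S : Finset squareLattice.edgeSet) : ℕ :=
  Nat.card (wiredGraph Λ ξ S).ConnectedComponent

/-- The weight `p ^ o(ω) * (1 - p) ^ c(ω) * q ^ k(ω, ξ)` of the configuration on `Λ` with set of
open edges `S ⊆ edgesIn Λ`. -/
def weight (p q : ℝ) (Λ : Finset (ℤ × ℤ)) (ξ : BoundaryCondition Λ)
    (S : Finset squareLattice.edgeSet) : ℝ :=
  p ^ S.card * (1 - p) ^ ((edgesIn Λ).card - S.card) * q ^ numClusters Λ ξ S

/-- The partition function. -/
def partitionFunction (p q : ℝ) (Λ : Finset (ℤ × ℤ)) (ξ : BoundaryCondition Λ) : ℝ :=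
  ∑ S ∈ (edgesIn Λ).powerset, weight p q Λ ξ S

/-- The FK percolation measure on the finite graph `Λ` with parameters `p, q` and boundary
condition `ξ`, seen as a measure on configurations of the whole lattice in which the edges that are
not in `Λ` are closed. -/
def finiteVolume (p q : ℝ) (Λ : Finset (ℤ × ℤ)) (ξ : BoundaryCondition Λ) : Measure Config :=
  ∑ S ∈ (edgesIn Λ).powerset,
    ENNReal.ofReal (weight p q Λ ξ S / partitionFunction p q Λ ξ) • Measure.dirac (ofOpenEdges S)

/-- `φ` is an infinite-volume FK percolation measure with parameters `p, q`: a probability measure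
that is the limit, on all events depending on finitely many edges, of finite-volume measures on a
sequence of boxes increasing to the lattice, with some boundary conditions on these boxes. -/
def IsInfiniteVolume (p q : ℝ) (φ : Measure Config) : Prop :=
  IsProbabilityMeasure φ ∧
    ∃ (N : ℕ → ℕ) (ξ : ∀ k, BoundaryCondition (box (N k))), StrictMono N ∧
      ∀ (E : Finset squareLattice.edgeSet) (A : Set (E → Bool)),
        Tendsto (fun k => finiteVolume p q (box (N k)) (ξ k) (cylinder E A)) atTop
          (𝓝 (φ (cylinder E A)))

end FK

end

/-! The Edwards–Sokal coupling relates the FK-Ising measure to the Ising model with bond weights `1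
+ t σσ'`, where `t = p / (2 - p)`, and with spins forced to agree on the classes of the boundary
condition. The probability that two sites are joined by open edges is at most the Ising two-point
function (`finiteVolume_le`), so it suffices to bound the latter exponentially, uniformly in the
boundary condition (`exists_twoPoint_le_exp`).

The Simon–Lieb inequality (`simon_lieb`) bounds the correlation of `y` and `x` by a sum over `u` on
a sphere around `y` of a free correlation of `y` and `u` inside the sphere times the full
correlation of `u` and `x`. The first factor ignores the boundary condition. Once the free
correlations sum to at most `1/2` over a sphere of some radius `m`, iteration gives exponential
decay.

That smallness comes from an exact computation. By Griffiths' inequality, pinning the spins at and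
below the height of `y` and wrapping the box onto a cylinder can only increase the correlation, so
it is at most the magnetization at the top of a cylinder of height `m` with pinned bottom. Put a
disorder line, along which horizontal couplings change sign, next to the spin. Local identities and
the symmetries of the cylinder show that raising both by one level multiplies the correlation by
exactly `t(1 + t)/(1 - t)`. At the top the line is empty; at the bottom the spin is `1` and the line
only lowers the partition function. Hence the magnetization is at most `(t(1 + t)/(1 - t)) ^ m`, and
the base is below `1` exactly when `t < √2 - 1`, that is `p < √2/(1 + √2)`.

All correlation inequalities rest on one principle: nonnegative combinations of real characters are
closed under products and have nonnegative sums. It is applied to pairs of replicas, after factoring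
one replica as the other times a relative spin. A finite-energy bound (`twoPoint_le_of_ne`) treats
distances below `m`, so that no constant is needed in front of the exponential. -/

namespace FK

/-! ### Functions of positive type on a finite group -/

/-- Combinations of real characters with nonnegative coefficients. -/
inductive PosType {G : Type*} [Group G] : (G → ℝ) → Prop
  | char (χ : G →* ℝ) : PosType χ
  | add {f g : G → ℝ} : PosType f → PosType g → PosType fun x => f x + g x
  | smul {f : G → ℝ} (c : ℝ) : 0 ≤ c → PosType f → PosType fun x => c * f x

theorem char_mul_self {G : Type*} [Group G] [Finite G] (χ : G →* ℝ) (g : G) : χ g * χ g = 1 := by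
  have h : (χ g) ^ orderOf g = 1 := by rw [← map_pow, pow_orderOf_eq_one, map_one]
  have h2 : |χ g| = 1 := by
    have : |χ g| ^ orderOf g = 1 := by rw [← abs_pow, h, abs_one]
    exact (pow_eq_one_iff_of_nonneg (abs_nonneg _) (orderOf_pos g).ne').1 this
  rw [← abs_mul_abs_self, h2, one_mul]

theorem abs_char {G : Type*} [Group G] [Finite G] (χ : G →* ℝ) (g : G) : |χ g| = 1 := by
  have h := char_mul_self χ g
  rcases mul_self_eq_one_iff.1 h with h | h <;> simp [h]

theorem char_le_one {G : Type*} [Group G] [Finite G] (χ : G →* ℝ) (g : G) : χ g ≤ 1 :=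
  (le_abs_self _).trans (abs_char χ g).le

theorem neg_one_le_char {G : Type*} [Group G] [Finite G] (χ : G →* ℝ) (g : G) : -1 ≤ χ g :=
  (abs_le.1 (abs_char χ g).le).1

namespace PosType

variable {G : Type*} [Group G] {f g : G → ℝ}

theorem const {c : ℝ} (hc : 0 ≤ c) : PosType fun _ : G => c := by
  have := (PosType.char (1 : G →* ℝ)).smul c hc
  simpa using this

theorem char_mul (χ : G →* ℝ) (hf : PosType f) : PosType fun x => χ x * f x := by
  induction hf with
  | char ψ => exact PosType.char (χ * ψ)
  | add _ _ h1 h2 => simpa only [mul_add] using h1.add h2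
  | smul c hc _ h => simpa only [mul_left_comm] using h.smul c hc

theorem mul (hf : PosType f) (hg : PosType g) : PosType fun x => f x * g x := by
  induction hf with
  | char ψ => exact char_mul ψ hg
  | add _ _ h1 h2 => simpa only [add_mul] using h1.add h2
  | smul c hc _ h => simpa only [mul_assoc] using h.smul c hc

theorem prod {ι : Type*} (s : Finset ι) {f : ι → G → ℝ} (h : ∀ i ∈ s, PosType (f i)) :
    PosType fun x => ∏ i ∈ s, f i x := by
  classical
  induction s using Finset.induction_on with
  | empty => simpa using const (G := G) zero_le_one
  | insert a s ha ih =>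
    simp only [Finset.prod_insert ha]
    exact (h a (by simp)).mul (ih fun i hi => h i (by simp [hi]))

/-- By orthogonality a nontrivial character sums to zero and the trivial one to the order of the
group. With closure under products, this is Griffiths' first inequality. -/
theorem sum_nonneg [Fintype G] (hf : PosType f) : 0 ≤ ∑ x, f x := by
  classical
  induction hf with
  | char χ =>
    rw [sum_hom_units]
    split_ifs <;> simp
  | add _ _ h1 h2 => rw [Finset.sum_add_distrib]; exact add_nonneg h1 h2
  | smul c hc _ h => rw [← Finset.mul_sum]; exact mul_nonneg hc h

theorem one_add {t : ℝ} (ht : 0 ≤ t) (χ : G →* ℝ) : PosType fun x => 1 + t * χ x :=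
  (const zero_le_one).add ((PosType.char χ).smul t ht)

/-- Coefficientwise bounds of the absolute value are preserved by products. -/
theorem prod_sub_and_add {ι : Type*} (s : Finset ι) {a b : ι → G → ℝ}
    (hs : ∀ i ∈ s, PosType fun x => a i x - b i x) (ha : ∀ i ∈ s, PosType fun x => a i x + b i x) :
    (PosType fun x => ∏ i ∈ s, a i x - ∏ i ∈ s, b i x) ∧
      PosType fun x => ∏ i ∈ s, a i x + ∏ i ∈ s, b i x := by
  classical
  induction s using Finset.induction_on with
  | empty =>
    refine ⟨?_, ?_⟩
    · simpa using const (G := G) le_rfl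
    · simpa using const (G := G) (c := 1 + 1) (by norm_num)
  | insert i s hi ih =>
    obtain ⟨h1, h2⟩ := ih (fun j hj => hs j (by simp [hj])) (fun j hj => ha j (by simp [hj]))
    have hsi := hs i (by simp)
    have hai := ha i (by simp)
    simp only [Finset.prod_insert hi]
    refine ⟨?_, ?_⟩
    -- Polarization: `2(aA - bB) = (a - b)(A + B) + (a + b)(A - B)`, and similarly for `aA + bB`.
    · convert ((hsi.mul h2).add (hai.mul h1)).smul (1 / 2) (by norm_num) using 2
      ring
    · convert ((hai.mul h2).add (hsi.mul h1)).smul (1 / 2) (by norm_num) using 2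
      ring

/-- Reversing the sign of some couplings decreases the partition function. -/
theorem sum_prod_le [Fintype G] {ι : Type*} (s : Finset ι) (χ : ι → G →* ℝ) {t : ℝ} (ht : 0 ≤ t)
    {ε : ι → ℝ} (hε : ∀ i, |ε i| ≤ 1) :
    ∑ x, ∏ i ∈ s, (1 + ε i * t * χ i x) ≤ ∑ x, ∏ i ∈ s, (1 + t * χ i x) := by
  have h := (prod_sub_and_add s (a := fun i x => 1 + t * χ i x)
    (b := fun i x => 1 + ε i * t * χ i x) (fun i _ => ?_) fun i _ => ?_).1.sum_nonneg
  · rw [Finset.sum_sub_distrib] at h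
    linarith
  · have := (PosType.char (χ i)).smul ((1 - ε i) * t)
      (mul_nonneg (by linarith [(abs_le.1 (hε i)).2]) ht)
    convert this using 2
    ring
  · have := (const (G := G) (c := 2) (by norm_num)).add ((PosType.char (χ i)).smul ((1 + ε i) * t)
      (mul_nonneg (by linarith [(abs_le.1 (hε i)).1]) ht))
    convert this using 2
    ring

/-- The two-replica weight of a coupling is of positive type for every relative spin. -/
theorem one_add_mul_one_add [Finite G] {t : ℝ} (ht : 0 ≤ t) (ht1 : t ≤ 1) (χ : G →* ℝ) {c : ℝ}
    (hc : |c| ≤ 1) : PosType fun x => (1 + t * χ x) * (1 + t * (χ x * c)) := by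
  have hc' := abs_le.1 hc
  have h : PosType fun x => (1 + t * t * c) + (t * (1 + c)) * χ x :=
    (const (by nlinarith [mul_nonneg ht ht])).add
      ((PosType.char χ).smul _ (mul_nonneg ht (by linarith)))
  convert h using 2 with x
  linear_combination t * t * c * char_mul_self χ x

end PosType

/-! ### Correlation inequalities -/

/-- Griffiths' second inequality, in the form of a comparison along a homomorphism of spin groups:
contracting spins and adding couplings increases correlations. -/
theorem correlation_le {G G' : Type*} [CommGroup G] [Fintype G] [CommGroup G'] [Fintype G']
    (h : G' →* G) (χ : G →* ℝ) (w : G → ℝ) (w' : G' → ℝ)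
    (H : ∀ τ : G, PosType fun x => w' x * w (h x * τ)) :
    (∑ g, χ g * w g) * ∑ x, w' x ≤ (∑ x, χ (h x) * w' x) * ∑ g, w g := by
  -- Ginibre's duplication: write the second replica as `g = h x * τ`. The difference becomes a sum
  -- over the relative spin `τ`, with nonnegative weight `1 - χ τ`.
  have key : (∑ x, χ (h x) * w' x) * ∑ g, w g - (∑ g, χ g * w g) * ∑ x, w' x
      = ∑ τ, (1 - χ τ) * ∑ x, χ (h x) * (w' x * w (h x * τ)) := by
    have e1 : (∑ x, χ (h x) * w' x) * ∑ g, w g = ∑ τ, ∑ x, χ (h x) * (w' x * w (h x * τ)) := by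
      rw [Finset.sum_mul, Finset.sum_comm]
      refine Finset.sum_congr rfl fun x _ => ?_
      rw [← Equiv.sum_comp (Equiv.mulLeft (h x)) w, Finset.mul_sum]
      exact Finset.sum_congr rfl fun τ _ => by simp [mul_assoc]
    have e2 : (∑ g, χ g * w g) * ∑ x, w' x
        = ∑ τ, χ τ * ∑ x, χ (h x) * (w' x * w (h x * τ)) := by
      rw [mul_comm, Finset.sum_mul]
      simp only [Finset.mul_sum]
      conv_rhs => rw [Finset.sum_comm]
      refine Finset.sum_congr rfl fun x _ => ?_
      rw [← Equiv.sum_comp (Equiv.mulLeft (h x))]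
      exact Finset.sum_congr rfl fun τ _ => by simp; ring
    rw [e1, e2, ← Finset.sum_sub_distrib]
    exact Finset.sum_congr rfl fun τ _ => by ring
  have : 0 ≤ ∑ τ, (1 - χ τ) * ∑ x, χ (h x) * (w' x * w (h x * τ)) :=
    Finset.sum_nonneg fun τ _ => mul_nonneg (by linarith [char_le_one χ τ])
      (PosType.char_mul (χ.comp h) (H τ)).sum_nonneg
  linarith

/-- Lieb's inequality: the couplings in `F` that touch the region `I` only join it to `I ∪ D`, and
the remaining weight does not depend on the spins in `I`. -/
theorem simon_lieb {G P ι : Type*} [CommGroup G] [Fintype G] (spin : P → G →* ℝ)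
    (F : Finset ι) (a b : ι → P) {t : ℝ} (ht : 0 ≤ t) (ht1 : t ≤ 1) {v : G → ℝ} (hv : PosType v)
    (I : Set P) (D : Finset P) {o x : P} (ho : o ∈ I) (hx : x ∉ I)
    (hab : ∀ e ∈ F, a e ∈ I → b e ∈ I ∨ b e ∈ D) (hba : ∀ e ∈ F, b e ∈ I → a e ∈ I ∨ a e ∈ D)
    (hflip : ∀ C ⊆ I, ∃ g : G, (∀ z ∈ C, spin z g = -1) ∧ (∀ z ∉ C, spin z g = 1) ∧
      ∀ σ, v (g * σ) = v σ) :
    (∑ σ, spin o σ * spin x σ * ((∏ e ∈ F, (1 + t * (spin (a e) σ * spin (b e) σ))) * v σ)) *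
        ∑ σ, ∏ e ∈ F, (1 + t * (spin (a e) σ * spin (b e) σ)) ≤
      ∑ u ∈ D, (∑ σ, spin o σ * spin u σ * ∏ e ∈ F, (1 + t * (spin (a e) σ * spin (b e) σ))) *
        ∑ σ, spin u σ * spin x σ *
          ((∏ e ∈ F, (1 + t * (spin (a e) σ * spin (b e) σ))) * v σ) := by
  classical
  set X : ι → G →* ℝ := fun e => spin (a e) * spin (b e) with hX
  set w : G → ℝ := fun σ => ∏ e ∈ F, (1 + t * X e σ) with hw
  change (∑ σ, spin o σ * spin x σ * (w σ * v σ)) * ∑ σ, w σ ≤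
    ∑ u ∈ D, (∑ σ, spin o σ * spin u σ * w σ) * ∑ σ, spin u σ * spin x σ * (w σ * v σ)
  -- Random-cluster expansion of the two replicas: on an edge of `S` the relative spin `τ` is forced
  -- to agree at the endpoints, and the factor left in `σ` is still of positive type.
  have hexp : ∀ σ τ : G, w σ * w (σ * τ) = ∑ S ∈ F.powerset,
      (∏ e ∈ S, (1 + 1 * X e τ)) * (∏ e ∈ S, (t * (t + X e σ))) * ∏ e ∈ F \ S, (1 - t * t) := by
    intro σ τ
    simp only [hw]
    rw [← Finset.prod_mul_distrib]
    have : ∀ e ∈ F, (1 + t * X e σ) * (1 + t * X e (σ * τ))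
        = (1 + 1 * X e τ) * (t * (t + X e σ)) + (1 - t * t) := by
      intro e _
      rw [map_mul]
      linear_combination t * t * X e τ * char_mul_self (X e) σ
    rw [Finset.prod_congr rfl this, Finset.prod_add]
    simp only [Finset.prod_mul_distrib]
  have hpair : ∀ (f k : G → ℝ), (∑ σ, f σ) * ∑ σ, k σ = ∑ σ, ∑ τ, f σ * k (σ * τ) := by
    intro f k
    rw [Finset.sum_mul]
    refine Finset.sum_congr rfl fun σ _ => ?_
    rw [← Equiv.sum_comp (Equiv.mulLeft σ) k, Finset.mul_sum]
    rfl
  have key : ∑ u ∈ D, (∑ σ, spin o σ * spin u σ * w σ) * ∑ σ, spin u σ * spin x σ * (w σ * v σ)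
      - (∑ σ, spin o σ * spin x σ * (w σ * v σ)) * ∑ σ, w σ
      = ∑ S ∈ F.powerset, (∏ e ∈ F \ S, (1 - t * t)) *
        (∑ τ, (∑ u ∈ D, spin o τ * spin u τ - 1) * ∏ e ∈ S, (1 + 1 * X e τ)) *
        ∑ σ, spin o σ * (spin x σ * (v σ * ∏ e ∈ S, (t * (t + X e σ)))) := by
    have e1 : ∀ u, (∑ σ, spin o σ * spin u σ * w σ) * ∑ σ, spin u σ * spin x σ * (w σ * v σ)
        = ∑ σ, ∑ τ, (spin o τ * spin u τ) * (spin o σ * spin x σ * v σ * (w σ * w (σ * τ))) := by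
      intro u
      rw [mul_comm, hpair]
      refine Finset.sum_congr rfl fun σ _ => Finset.sum_congr rfl fun τ _ => ?_
      simp only [map_mul]
      linear_combination (spin o τ * spin u τ * (spin o σ * spin x σ * v σ * (w σ * w (σ * τ)))) *
        char_mul_self (spin u) σ
    simp only [e1]
    rw [hpair, Finset.sum_comm, ← Finset.sum_sub_distrib]
    have e2 : ∀ σ, (∑ u ∈ D, ∑ τ, (spin o τ * spin u τ) *
          (spin o σ * spin x σ * v σ * (w σ * w (σ * τ)))) -
          ∑ τ, spin o σ * spin x σ * (w σ * v σ) * w (σ * τ)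
        = ∑ τ, ∑ S ∈ F.powerset, (∏ e ∈ F \ S, (1 - t * t)) *
        ((∑ u ∈ D, spin o τ * spin u τ - 1) * ∏ e ∈ S, (1 + 1 * X e τ)) *
        (spin o σ * (spin x σ * (v σ * ∏ e ∈ S, (t * (t + X e σ))))) := by
      intro σ
      rw [Finset.sum_comm, ← Finset.sum_sub_distrib]
      refine Finset.sum_congr rfl fun τ _ => ?_
      rw [← Finset.sum_mul]
      trans (∑ u ∈ D, spin o τ * spin u τ - 1) * (spin o σ * spin x σ * v σ) * (w σ * w (σ * τ))
      · ring
      · rw [hexp, Finset.mul_sum]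
        exact Finset.sum_congr rfl fun S _ => by ring
    rw [Finset.sum_congr rfl fun σ _ => e2 σ]
    have e3 : ∀ σ : G, (∑ τ, ∑ S ∈ F.powerset, (∏ e ∈ F \ S, (1 - t * t)) *
        ((∑ u ∈ D, spin o τ * spin u τ - 1) * ∏ e ∈ S, (1 + 1 * X e τ)) *
        (spin o σ * (spin x σ * (v σ * ∏ e ∈ S, (t * (t + X e σ)))))) =
        ∑ S ∈ F.powerset, (∏ e ∈ F \ S, (1 - t * t)) *
        (∑ τ, (∑ u ∈ D, spin o τ * spin u τ - 1) * ∏ e ∈ S, (1 + 1 * X e τ)) *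
        (spin o σ * (spin x σ * (v σ * ∏ e ∈ S, (t * (t + X e σ))))) := by
      intro σ
      rw [Finset.sum_comm]
      refine Finset.sum_congr rfl fun S _ => ?_
      rw [← Finset.sum_mul, ← Finset.mul_sum]
    rw [Finset.sum_congr rfl fun σ _ => e3 σ, Finset.sum_comm]
    refine Finset.sum_congr rfl fun S _ => ?_
    rw [← Finset.mul_sum]
  rw [← sub_nonneg, key]
  refine Finset.sum_nonneg fun S hS => ?_
  have hSF := Finset.mem_powerset.1 hS
  have hA : 0 ≤ ∏ e ∈ F \ S, (1 - t * t) := Finset.prod_nonneg fun _ _ => by nlinarith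
  have hPS : PosType fun τ => ∏ e ∈ S, (1 + 1 * X e τ) :=
    PosType.prod S fun e _ => PosType.one_add zero_le_one (X e)
  have hC : 0 ≤ ∑ σ, spin o σ * (spin x σ * (v σ * ∏ e ∈ S, (t * (t + X e σ)))) := by
    refine (PosType.char_mul _ (PosType.char_mul _ (hv.mul (PosType.prod S fun e _ => ?_)))).sum_nonneg
    exact ((PosType.const ht).add (PosType.char (X e))).smul t ht
  set r : P → P → Prop := fun y z => ∃ e ∈ S, (a e = y ∧ b e = z) ∨ (b e = y ∧ a e = z) with hr
  -- Each `S` contributes a product of a `τ`-sum and a `σ`-sum. If `S` joins `o` to `D`, both are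
  -- nonnegative; otherwise the `σ`-sum vanishes.
  by_cases hreach : ∃ u ∈ D, Relation.ReflTransGen r o u
  · obtain ⟨u, hu, hou⟩ := hreach
    refine mul_nonneg (mul_nonneg hA ?_) hC
    have hcon : ∀ τ, (∏ e ∈ S, (1 + 1 * X e τ)) ≠ 0 → spin o τ = spin u τ := by
      intro τ hτ
      have hedge : ∀ e ∈ S, spin (a e) τ = spin (b e) τ := by
        intro e he
        have h1 : 1 + 1 * X e τ ≠ 0 := fun h => hτ (Finset.prod_eq_zero he h)
        have h2 : X e τ = spin (a e) τ * spin (b e) τ := rfl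
        rcases mul_self_eq_one_iff.1 (char_mul_self (spin (a e)) τ) with h3 | h3 <;>
        rcases mul_self_eq_one_iff.1 (char_mul_self (spin (b e)) τ) with h4 | h4 <;>
        simp_all
      clear hu
      induction hou with
      | refl => rfl
      | tail _ h ih =>
        obtain ⟨e, he, ⟨h1, h2⟩ | ⟨h1, h2⟩⟩ := h
        · rw [ih, ← h1, ← h2, hedge e he]
        · rw [ih, ← h1, ← h2, hedge e he]
    -- On the support of the product, `o` and `u` have equal relative spin, so the term of `u`
    -- cancels the `-1`.
    have hsplit : ∀ τ, (∑ u ∈ D, spin o τ * spin u τ - 1) * ∏ e ∈ S, (1 + 1 * X e τ)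
        = ∑ z ∈ D.erase u, spin o τ * (spin z τ * ∏ e ∈ S, (1 + 1 * X e τ)) := by
      intro τ
      rw [← Finset.add_sum_erase D _ hu]
      by_cases hτ : (∏ e ∈ S, (1 + 1 * X e τ)) = 0
      · simp only [hτ, mul_zero, Finset.sum_const_zero]
      · rw [hcon τ hτ, char_mul_self, add_sub_cancel_left, Finset.sum_mul]
        simp only [mul_assoc]
    rw [Finset.sum_congr rfl fun τ _ => hsplit τ, Finset.sum_comm]
    exact Finset.sum_nonneg fun z _ =>
      (PosType.char_mul _ (PosType.char_mul _ hPS)).sum_nonneg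
  · push Not at hreach
    have hCI : {z | Relation.ReflTransGen r o z} ⊆ I := by
      intro z hz
      induction hz with
      | refl => exact ho
      | @tail y z hy h ih =>
        have hzD : z ∉ D := fun h' => hreach z h' (hy.tail h)
        obtain ⟨e, he, ⟨h1, h2⟩ | ⟨h1, h2⟩⟩ := h
        · subst h1 h2
          exact (hab e (hSF he) ih).resolve_right hzD
        · subst h1 h2
          exact (hba e (hSF he) ih).resolve_right hzD
    -- Flipping the cluster of `o`, which stays in `I`, negates the spin at `o` and preserves the
    -- spin at `x`, the weight `v` and every edge factor of `S`.
    obtain ⟨g, hg1, hg2, hg3⟩ := hflip _ hCI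
    have hzero : ∑ σ, spin o σ * (spin x σ * (v σ * ∏ e ∈ S, (t * (t + X e σ)))) = 0 := by
      have hneg : ∑ σ, spin o σ * (spin x σ * (v σ * ∏ e ∈ S, (t * (t + X e σ))))
          = - ∑ σ, spin o σ * (spin x σ * (v σ * ∏ e ∈ S, (t * (t + X e σ)))) := by
        conv_lhs => rw [← Equiv.sum_comp (Equiv.mulLeft g)]
        rw [← Finset.sum_neg_distrib]
        refine Finset.sum_congr rfl fun σ _ => ?_
        have hprod : ∏ e ∈ S, (t * (t + X e (g * σ))) = ∏ e ∈ S, (t * (t + X e σ)) := by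
          refine Finset.prod_congr rfl fun e he => ?_
          have : X e g = 1 := by
            change spin (a e) g * spin (b e) g = 1
            by_cases hae : Relation.ReflTransGen r o (a e)
            · rw [hg1 _ hae, hg1 _ (hae.tail ⟨e, he, Or.inl ⟨rfl, rfl⟩⟩)]; norm_num
            · have hbe : ¬ Relation.ReflTransGen r o (b e) := fun h =>
                hae (h.tail ⟨e, he, Or.inr ⟨rfl, rfl⟩⟩)
              rw [hg2 _ hae, hg2 _ hbe]; norm_num
          rw [map_mul, this, one_mul]
        simp only [Equiv.coe_mulLeft]
        rw [map_mul, map_mul, hg1 o Relation.ReflTransGen.refl, hg2 x fun h => hx (hCI h), hg3,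
          hprod]
        ring
      linarith
    rw [hzero, mul_zero]

end FK

noncomputable section

namespace FK

/-! ### Spins on a finite set of sites -/

open Classical in
/-- The spin at `x`, for configurations on `Λ`; it is `1` when `x` is not in `Λ`. -/
def spin {P : Type*} (Λ : Finset P) (x : P) : (Λ → ℤˣ) →* ℝ :=
  if h : x ∈ Λ then
    ((Int.castRingHom ℝ : ℤ →* ℝ).comp (Units.coeHom ℤ)).comp (Pi.evalMonoidHom _ ⟨x, h⟩)
  else 1

section Spin

variable {P : Type*} {Λ : Finset P} {x : P}

theorem spin_of_mem (h : x ∈ Λ) (σ : Λ → ℤˣ) : spin Λ x σ = ((σ ⟨x, h⟩ : ℤˣ) : ℤ) := by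
  simp [spin, h]

theorem spin_of_notMem (h : x ∉ Λ) (σ : Λ → ℤˣ) : spin Λ x σ = 1 := by
  simp [spin, h]

theorem exists_spin_eq_neg_one (Λ : Finset P) (C : Set P) :
    ∃ g : Λ → ℤˣ, (∀ z ∈ Λ, z ∈ C → spin Λ z g = -1) ∧ ∀ z, z ∉ C → spin Λ z g = 1 := by
  classical
  refine ⟨fun z => if z.1 ∈ C then -1 else 1, fun z hz hC => ?_, fun z hC => ?_⟩
  · simp [spin_of_mem hz, hC]
  · by_cases hz : z ∈ Λ
    · simp [spin_of_mem hz, hC]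
    · exact spin_of_notMem hz _

theorem exists_perm_spin (π : Equiv.Perm P) (hπ : ∀ x, x ∈ Λ ↔ π x ∈ Λ) :
    ∃ T : Equiv.Perm (Λ → ℤˣ), ∀ x σ, spin Λ x (T σ) = spin Λ (π x) σ := by
  refine ⟨Equiv.arrowCongr (π.subtypeEquiv hπ).symm (Equiv.refl _), fun x σ => ?_⟩
  by_cases hx : x ∈ Λ
  · rw [spin_of_mem hx, spin_of_mem ((hπ x).1 hx)]
    simp
  · rw [spin_of_notMem hx, spin_of_notMem fun h => hx ((hπ x).2 h)]

end Spin

/-! ### The Ising model on a cylinder -/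

/-- The sites of the cylinder of circumference `L` that are at heights `1, …, m`. The spins below
height `1` are fixed to be `1`. -/
def cylSites (L m : ℕ) [NeZero L] : Finset (ZMod L × ℤ) := Finset.univ ×ˢ Finset.Icc 1 (m : ℤ)

/-- The edges of the cylinder: `(k, j, false)` is the horizontal edge from `(k, j)` to `(k + 1, j)`,
and `(k, j, true)` is the vertical edge from `(k, j)` to `(k, j + 1)`. -/
def cylEdges (L m : ℕ) [NeZero L] : Finset (ZMod L × ℤ × Bool) :=
  (Finset.univ ×ˢ Finset.Icc 0 (m : ℤ) ×ˢ Finset.univ).filter fun e =>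
    if e.2.2 then e.2.1 < m else 1 ≤ e.2.1

/-- The upper or right endpoint of an edge of the cylinder. -/
def cylEnd {L : ℕ} (e : ZMod L × ℤ × Bool) : ZMod L × ℤ :=
  if e.2.2 then (e.1, e.2.1 + 1) else (e.1 + 1, e.2.1)

section Cylinder

variable {L m : ℕ} [NeZero L]

theorem mem_cylSites {x : ZMod L × ℤ} : x ∈ cylSites L m ↔ 1 ≤ x.2 ∧ x.2 ≤ m := by
  simp [cylSites, Finset.mem_product]

theorem mk_true_mem_cylEdges {k : ZMod L} {j : ℤ} :
    (k, j, true) ∈ cylEdges L m ↔ 0 ≤ j ∧ j < m := by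
  simp [cylEdges]
  omega

theorem mk_false_mem_cylEdges {k : ZMod L} {j : ℤ} :
    (k, j, false) ∈ cylEdges L m ↔ 1 ≤ j ∧ j ≤ m := by
  simp [cylEdges]
  omega

variable (L m)

/-- The product of the two spins at the endpoints of an edge. -/
def cylChar (e : ZMod L × ℤ × Bool) : (cylSites L m → ℤˣ) →* ℝ :=
  spin (cylSites L m) (e.1, e.2.1) * spin (cylSites L m) (cylEnd e)

/-- The weight of a configuration, when the coupling of the edge `e` is multiplied by `ε e`. -/
def cylWeight (t : ℝ) (ε : ZMod L × ℤ × Bool → ℝ) (σ : cylSites L m → ℤˣ) : ℝ :=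
  ∏ e ∈ cylEdges L m, (1 + ε e * t * cylChar L m e σ)

/-- The signs of a disorder line that goes up from the face to the right of the column `c` and
just above height `h`. -/
def disorder (c : ZMod L) (h : ℤ) (e : ZMod L × ℤ × Bool) : ℝ :=
  if e.2.2 = false ∧ e.1 = c ∧ h < e.2.1 then -1 else 1

variable {L m}

/-- Gauge covariance: flipping spins amounts to changing the signs of couplings, which makes it
possible to deform a disorder line. -/
theorem cylWeight_mul_left (t : ℝ) (ε : ZMod L × ℤ × Bool → ℝ) (g σ : cylSites L m → ℤˣ) :
    cylWeight L m t ε (g * σ) = cylWeight L m t (fun e => ε e * cylChar L m e g) σ :=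
  Finset.prod_congr rfl fun e _ => by rw [map_mul]; ring

theorem cylWeight_perm {t : ℝ} {ε ε' : ZMod L × ℤ × Bool → ℝ} {T : Equiv.Perm (cylSites L m → ℤˣ)}
    {ρ : ZMod L × ℤ × Bool → ZMod L × ℤ × Bool} (hρ : Function.Bijective ρ)
    (hmem : ∀ e, e ∈ cylEdges L m ↔ ρ e ∈ cylEdges L m)
    (hT : ∀ e σ, cylChar L m e (T σ) = cylChar L m (ρ e) σ) (hε : ∀ e, ε e = ε' (ρ e))
    (σ : cylSites L m → ℤˣ) : cylWeight L m t ε (T σ) = cylWeight L m t ε' σ :=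
  Finset.prod_bijective ρ hρ hmem fun e _ => by rw [hT, hε]

/-- The two weights differ in one factor only; the relation is kept free of denominators. -/
theorem cylWeight_change_sign {t : ℝ} {ε ε' : ZMod L × ℤ × Bool → ℝ} {e₀ : ZMod L × ℤ × Bool}
    (he₀ : e₀ ∈ cylEdges L m) (h1 : ε e₀ = 1) (h2 : ε' e₀ = -1)
    (h : ∀ e ∈ cylEdges L m, e ≠ e₀ → ε e = ε' e) (σ : cylSites L m → ℤˣ) :
    cylWeight L m t ε' σ * (1 + t * cylChar L m e₀ σ)
      = cylWeight L m t ε σ * (1 - t * cylChar L m e₀ σ) := by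
  classical
  unfold cylWeight
  rw [← Finset.mul_prod_erase _ _ he₀, ← Finset.mul_prod_erase _ _ he₀, h1, h2]
  have : ∏ e ∈ (cylEdges L m).erase e₀, (1 + ε e * t * cylChar L m e σ)
      = ∏ e ∈ (cylEdges L m).erase e₀, (1 + ε' e * t * cylChar L m e σ) :=
    Finset.prod_congr rfl fun e he => by
      rw [h e (Finset.mem_of_mem_erase he) (Finset.ne_of_mem_erase he)]
  rw [this]
  ring

/-! ### Exact recursion for spin-disorder correlations -/

/-- The spin-disorder correlations are invariant under reflection in the disorder line. -/
theorem sum_spin_one_mul_disorder_zero (t : ℝ) (h j : ℤ) :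
    ∑ σ, spin (cylSites L m) (1, j) σ * cylWeight L m t (disorder L 0 h) σ
      = ∑ σ, spin (cylSites L m) (0, j) σ * cylWeight L m t (disorder L 0 h) σ := by
  obtain ⟨T, hT⟩ := exists_perm_spin (Λ := cylSites L m)
    ((Equiv.subLeft (1 : ZMod L)).prodCongr (Equiv.refl ℤ)) fun x => by simp [mem_cylSites]
  let ρ : ZMod L × ℤ × Bool → ZMod L × ℤ × Bool := fun e => (if e.2.2 then 1 - e.1 else -e.1, e.2)
  have hinv : Function.Involutive ρ := by
    rintro ⟨k, i, b⟩
    cases b <;> simp [ρ]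
  have hw : ∀ σ, cylWeight L m t (disorder L 0 h) (T σ) = cylWeight L m t (disorder L 0 h) σ := by
    refine cylWeight_perm hinv.bijective ?_ ?_ ?_
    · rintro ⟨k, i, b⟩
      cases b <;> simp [ρ, mk_true_mem_cylEdges, mk_false_mem_cylEdges]
    · rintro ⟨k, i, b⟩ σ
      cases b
      · simp [ρ, cylChar, cylEnd, hT]
        rw [mul_comm, sub_eq_neg_add]
      · simp [ρ, cylChar, cylEnd, hT]
    · rintro ⟨k, i, b⟩
      cases b <;> simp [ρ, disorder]
  rw [← Equiv.sum_comp T]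
  refine Finset.sum_congr rfl fun σ _ => ?_
  rw [hT, hw]
  simp

/-- The spin-disorder correlations are invariant under rotation of the cylinder. -/
theorem sum_spin_one_mul_disorder_one (t : ℝ) (h j : ℤ) :
    ∑ σ, spin (cylSites L m) (1, j) σ * cylWeight L m t (disorder L 1 h) σ
      = ∑ σ, spin (cylSites L m) (0, j) σ * cylWeight L m t (disorder L 0 h) σ := by
  obtain ⟨T, hT⟩ := exists_perm_spin (Λ := cylSites L m)
    ((Equiv.addRight (1 : ZMod L)).prodCongr (Equiv.refl ℤ)) fun x => by simp [mem_cylSites]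
  have hw : ∀ σ, cylWeight L m t (disorder L 0 h) (T σ) = cylWeight L m t (disorder L 1 h) σ := by
    refine cylWeight_perm (ρ := (Equiv.addRight (1 : ZMod L)).prodCongr (Equiv.refl _))
      (Equiv.bijective _) ?_ ?_ ?_
    · rintro ⟨k, i, b⟩
      cases b <;> simp [mk_true_mem_cylEdges, mk_false_mem_cylEdges]
    · rintro ⟨k, i, b⟩ σ
      cases b <;> simp [cylChar, cylEnd, hT]
    · rintro ⟨k, i, b⟩
      cases b <;> simp [disorder]
  rw [← Equiv.sum_comp T fun σ => spin (cylSites L m) (0, j) σ * _]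
  refine Finset.sum_congr rfl fun σ _ => ?_
  rw [hT, hw]
  simp

/-- Raising the end of the disorder line past height `h` restores the sign of one horizontal edge.
After multiplication by the spin at `(0, h)`, the change of weight involves only the spins at its
two endpoints, whose sums agree by reflection. -/
theorem spin_disorder_horizontal (t : ℝ) {h : ℤ} (h1 : 1 ≤ h) (hm : h ≤ m) :
    (1 + t) * ∑ σ, spin (cylSites L m) (0, h) σ * cylWeight L m t (disorder L 0 (h - 1)) σ
      = (1 - t) * ∑ σ, spin (cylSites L m) (0, h) σ * cylWeight L m t (disorder L 0 h) σ := by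
  have key : ∀ σ, (spin (cylSites L m) (0, h) σ + t * spin (cylSites L m) (1, h) σ) *
        cylWeight L m t (disorder L 0 (h - 1)) σ
      = (spin (cylSites L m) (0, h) σ - t * spin (cylSites L m) (1, h) σ) *
        cylWeight L m t (disorder L 0 h) σ := by
    intro σ
    have := cylWeight_change_sign (L := L) (m := m) (t := t) (ε := disorder L 0 h)
      (ε' := disorder L 0 (h - 1)) (e₀ := (0, h, false)) (mk_false_mem_cylEdges.2 ⟨h1, hm⟩)
      (by simp [disorder]) (by simp [disorder]) ?_ σ
    · have hX : cylChar L m (0, h, false) σ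
          = spin (cylSites L m) (0, h) σ * spin (cylSites L m) (1, h) σ := by
        simp [cylChar, cylEnd]
      rw [hX] at this
      have hsq := char_mul_self (spin (cylSites L m) (0, h)) σ
      linear_combination (spin (cylSites L m) (0, h) σ) * this -
        t * spin (cylSites L m) (1, h) σ * (cylWeight L m t (disorder L 0 (h - 1)) σ +
          cylWeight L m t (disorder L 0 h) σ) * hsq
    · rintro ⟨k, i, b⟩ _ hne
      unfold disorder
      cases b
      · have : k = 0 → i ≠ h := by rintro rfl rfl; exact hne rfl
        by_cases hk : k = 0
        · have hi := this hk
          have : h - 1 < i ↔ h < i := by omega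
          simp [this]
        · simp [hk]
      · simp
  have hsum := Finset.sum_congr (s₁ := Finset.univ) rfl fun σ _ => key σ
  simp only [add_mul, sub_mul, Finset.sum_add_distrib, Finset.sum_sub_distrib, mul_assoc,
    ← Finset.mul_sum, sum_spin_one_mul_disorder_zero] at hsum
  linarith

/-- The line can be moved from column `0` to column `1` by flipping the spins of column `1` above
height `h`, at the cost of one reversed vertical edge. Reflection and rotation identify all the
resulting sums with sums at column `0`. -/
theorem spin_disorder_vertical (hL : 2 ≤ L) (t : ℝ) {h : ℤ} (h0 : 0 ≤ h) (hm : h < m) :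
    ∑ σ, spin (cylSites L m) (0, h + 1) σ * cylWeight L m t (disorder L 0 h) σ
      = t * ∑ σ, spin (cylSites L m) (0, h) σ * cylWeight L m t (disorder L 0 h) σ := by
  classical
  have : Fact (1 < L) := ⟨hL⟩
  obtain ⟨g, hg1, hg2⟩ := exists_spin_eq_neg_one (cylSites L m) {x | x.1 = 1 ∧ h < x.2}
  have hgs : ∀ k j, spin (cylSites L m) (k, j) g
      = if (k = 1 ∧ h < j) ∧ j ≤ m then -1 else 1 := by
    intro k j
    split_ifs with hc
    · exact hg1 _ (mem_cylSites.2 ⟨by simp; omega, hc.2⟩) hc.1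
    · by_cases hj : k = 1 ∧ h < j
      · exact spin_of_notMem (fun hmem => hc ⟨hj, (mem_cylSites.1 hmem).2⟩) g
      · exact hg2 _ hj
  have key : ∀ σ, spin (cylSites L m) (1, h + 1) σ * (1 + t * cylChar L m (1, h, true) σ) *
        cylWeight L m t (disorder L 0 h) (g * σ)
      = spin (cylSites L m) (1, h + 1) σ * (1 - t * cylChar L m (1, h, true) σ) *
        cylWeight L m t (disorder L 1 h) σ := by
    intro σ
    have := cylWeight_change_sign (L := L) (m := m) (t := t) (ε := disorder L 1 h)
      (ε' := fun e => disorder L 0 h e * cylChar L m e g) (e₀ := (1, h, true))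
      (mk_true_mem_cylEdges.2 ⟨h0, hm⟩) (by simp [disorder]) ?_ ?_ σ
    · rw [cylWeight_mul_left]
      linear_combination spin (cylSites L m) (1, h + 1) σ * this
    · simp [disorder, cylChar, cylEnd, hgs]
      omega
    · rintro ⟨k, i, b⟩ hmem hne
      cases b
      · have hi := mk_false_mem_cylEdges.1 hmem
        simp only [disorder, cylChar, cylEnd, MonoidHom.mul_apply, hgs, hi.2, and_true]
        by_cases hih : h < i
        · by_cases hk0 : k = 0
          · subst hk0; simp [hih, hi.2]
          · by_cases hk1 : k = 1
            · subst hk1; simp [hih]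
            · simp [hih, hk0, hk1]
        · simp [hih]
      · have hi := mk_true_mem_cylEdges.1 hmem
        simp only [disorder, cylChar, cylEnd, MonoidHom.mul_apply, hgs]
        by_cases hk1 : k = 1
        · have hih : i ≠ h := by rintro rfl; exact hne (by rw [hk1])
          have e1 : h < i + 1 ↔ h < i := by omega
          have e2 : i + 1 ≤ m := by omega
          have e3 : i ≤ m := by omega
          by_cases hlt : h < i <;> simp [hk1, e1, e2, e3, hlt]
        · simp [hk1]
  have hsum := Finset.sum_congr (s₁ := Finset.univ) rfl fun σ _ => key σ
  -- Undo the flip on the left side, so that its weight becomes that of the original line.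
  rw [← Equiv.sum_comp (Equiv.mulLeft g)] at hsum
  have hgg : g * g = 1 := by
    funext z
    simp only [Pi.mul_apply, Pi.one_apply, Int.units_mul_self]
  have hX : ∀ σ, cylChar L m (1, h, true) σ
      = spin (cylSites L m) (1, h) σ * spin (cylSites L m) (1, h + 1) σ := fun σ => by
    simp [cylChar, cylEnd]
  have hlhs : ∀ σ, spin (cylSites L m) (1, h + 1) (g * σ) *
        (1 + t * cylChar L m (1, h, true) (g * σ)) * cylWeight L m t (disorder L 0 h) (g * (g * σ))
      = t * (spin (cylSites L m) (1, h) σ * cylWeight L m t (disorder L 0 h) σ)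
        - spin (cylSites L m) (1, h + 1) σ * cylWeight L m t (disorder L 0 h) σ := by
    intro σ
    rw [← mul_assoc, hgg, one_mul, hX, map_mul, map_mul, hgs, hgs]
    have hh : h + 1 ≤ m := by omega
    simp only [lt_irrefl, and_false, false_and, if_false, hh, and_true, lt_add_one, if_true]
    have hsq := char_mul_self (spin (cylSites L m) (1, h + 1)) σ
    linear_combination t * spin (cylSites L m) (1, h) σ * cylWeight L m t (disorder L 0 h) σ * hsq
  have hrhs : ∀ σ, spin (cylSites L m) (1, h + 1) σ *
        (1 - t * cylChar L m (1, h, true) σ) * cylWeight L m t (disorder L 1 h) σ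
      = spin (cylSites L m) (1, h + 1) σ * cylWeight L m t (disorder L 1 h) σ
        - t * (spin (cylSites L m) (1, h) σ * cylWeight L m t (disorder L 1 h) σ) := by
    intro σ
    rw [hX]
    have hsq := char_mul_self (spin (cylSites L m) (1, h + 1)) σ
    linear_combination -t * spin (cylSites L m) (1, h) σ * cylWeight L m t (disorder L 1 h) σ * hsq
  simp only [Equiv.coe_mulLeft] at hsum
  rw [Finset.sum_congr rfl fun σ _ => hlhs σ, Finset.sum_congr rfl fun σ _ => hrhs σ,
    Finset.sum_sub_distrib, Finset.sum_sub_distrib, ← Finset.mul_sum, ← Finset.mul_sum,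
    sum_spin_one_mul_disorder_zero, sum_spin_one_mul_disorder_zero,
    sum_spin_one_mul_disorder_one, sum_spin_one_mul_disorder_one] at hsum
  linarith

/-- Alternating the vertical and the horizontal relation raises spin and line together, with the
factor `t · (1 + t)/(1 - t)`. The recursion starts at the pinned spin at height `0`. -/
theorem sum_spin_mul_disorder (hL : 2 ≤ L) {t : ℝ} (ht1 : t < 1) (h : ℕ) (hm : h ≤ m) :
    ∑ σ, spin (cylSites L m) (0, (h : ℤ)) σ * cylWeight L m t (disorder L 0 h) σ
      = (t * (1 + t) / (1 - t)) ^ h * ∑ σ, cylWeight L m t (disorder L 0 0) σ := by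
  induction h with
  | zero =>
    rw [pow_zero, one_mul]
    refine Finset.sum_congr rfl fun σ _ => ?_
    rw [spin_of_notMem (by simp [mem_cylSites]), one_mul, Nat.cast_zero]
  | succ h ih =>
    have h1 := spin_disorder_horizontal (L := L) (m := m) t (h := ((h + 1 : ℕ) : ℤ)) (by simp)
      (by exact_mod_cast hm)
    have h2 := spin_disorder_vertical (L := L) (m := m) hL t (h := (h : ℤ)) (by simp)
      (by exact_mod_cast hm)
    have e : ((h + 1 : ℕ) : ℤ) - 1 = h := by push_cast; ring
    rw [e] at h1
    rw [← Nat.cast_succ, ih (by omega)] at h2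
    rw [Nat.succ_eq_add_one] at h2
    rw [h2] at h1
    rw [pow_succ]
    have hne : (1 - t) ≠ 0 := by linarith
    field_simp
    linarith

/-- The magnetization at the free top of a cylinder of height `m` with pinned bottom. -/
theorem cylinder_magnetization_le (hL : 2 ≤ L) {t : ℝ} (ht0 : 0 ≤ t) (ht1 : t < 1) :
    ∑ σ, spin (cylSites L m) (0, (m : ℤ)) σ *
        ∏ e ∈ cylEdges L m, (1 + t * cylChar L m e σ)
      ≤ (t * (1 + t) / (1 - t)) ^ m * ∑ σ, ∏ e ∈ cylEdges L m, (1 + t * cylChar L m e σ) := by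
  have h1 : ∀ σ, ∏ e ∈ cylEdges L m, (1 + t * cylChar L m e σ)
      = cylWeight L m t (disorder L 0 m) σ := by
    intro σ
    refine Finset.prod_congr rfl ?_
    rintro ⟨k, i, b⟩ he
    cases b
    · have := mk_false_mem_cylEdges.1 he
      simp [disorder, this.2]
    · simp [disorder]
  -- The line starting at height `0` crosses the whole cylinder: this compares antiperiodic with
  -- periodic couplings.
  have h2 := PosType.sum_prod_le (cylEdges L m) (cylChar L m) ht0 (ε := disorder L 0 0) fun e => by
    unfold disorder; split_ifs <;> simp
  have h3 := sum_spin_mul_disorder (m := m) hL ht1 m le_rfl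
  rw [Finset.sum_congr rfl fun σ _ => by rw [h1 σ], h3]
  exact mul_le_mul_of_nonneg_left h2 (pow_nonneg (div_nonneg (by positivity) (by linarith)) _)

end Cylinder

end FK

end

noncomputable section

namespace FK

/-! ### Comparison of a box with a cylinder -/

/-- Supplies the hypothesis of `correlation_le`. Each edge of `F` that survives is paired with its
image, the other edges of `E'` are ferromagnetic factors, and edges sent outside `E'` become
nonnegative constants. Injectivity ensures that no image is used twice. -/
theorem posType_prod_mul_prod {G G' ι ι' : Type*} [CommGroup G] [Finite G] [CommGroup G'] [Finite G']
    (h : G' →* G) (F : Finset ι) (X : ι → G →* ℝ) (E' : Finset ι') (X' : ι' → G' →* ℝ) (f : ι → ι')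
    {t : ℝ} (ht0 : 0 ≤ t) (ht1 : t ≤ 1)
    (h1 : ∀ i ∈ F, f i ∈ E' → ∀ g, X i (h g) = X' (f i) g)
    (h0 : ∀ i ∈ F, f i ∉ E' → ∀ g, X i (h g) = 1)
    (hinj : ∀ i ∈ F, ∀ j ∈ F, f i ∈ E' → f i = f j → i = j) (τ : G) :
    PosType fun x => (∏ e ∈ E', (1 + t * X' e x)) * ∏ i ∈ F, (1 + t * X i (h x * τ)) := by
  classical
  set F₁ := F.filter fun i => f i ∈ E' with hF₁
  have himg : F₁.image f ⊆ E' := by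
    intro e he
    obtain ⟨i, hi, rfl⟩ := Finset.mem_image.1 he
    exact (Finset.mem_filter.1 hi).2
  have hA : PosType fun x => ∏ i ∈ F₁, (1 + t * X' (f i) x) * (1 + t * (X' (f i) x * X i τ)) :=
    PosType.prod F₁ fun i _ => PosType.one_add_mul_one_add ht0 ht1 _ (abs_char _ _).le
  have hB : PosType fun x => ∏ e ∈ E' \ F₁.image f, (1 + t * X' e x) :=
    PosType.prod _ fun i _ => PosType.one_add ht0 _
  have hC : 0 ≤ ∏ i ∈ F.filter (fun i => ¬ f i ∈ E'), (1 + t * X i τ) :=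
    Finset.prod_nonneg fun i _ => by nlinarith [neg_one_le_char (X i) τ]
  convert (hA.mul hB).smul _ hC using 2 with x
  rw [← Finset.prod_sdiff himg, Finset.prod_image, ← Finset.prod_filter_mul_prod_filter_not F
    (fun i => f i ∈ E') (fun i => 1 + t * X i (h x * τ)), Finset.prod_mul_distrib]
  · have e1 : ∏ i ∈ F₁, (1 + t * X i (h x * τ)) = ∏ i ∈ F₁, (1 + t * (X' (f i) x * X i τ)) :=
      Finset.prod_congr rfl fun i hi => by
        rw [map_mul, h1 i (Finset.mem_filter.1 hi).1 (Finset.mem_filter.1 hi).2]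
    have e2 : ∏ i ∈ F.filter (fun i => ¬ f i ∈ E'), (1 + t * X i (h x * τ))
        = ∏ i ∈ F.filter (fun i => ¬ f i ∈ E'), (1 + t * X i τ) :=
      Finset.prod_congr rfl fun i hi => by
        rw [map_mul, h0 i (Finset.mem_filter.1 hi).1 (Finset.mem_filter.1 hi).2, one_mul]
    rw [← hF₁, e1, e2]
    ring
  · intro i hi j hj hij
    have hi' := Finset.mem_filter.1 (Finset.mem_coe.1 hi)
    have hj' := Finset.mem_filter.1 (Finset.mem_coe.1 hj)
    exact hinj i hi'.1 j hj'.1 hi'.2 hij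

/-! ### Coordinates of lattice edges, and wrapping onto the cylinder -/

/-- One endpoint of an edge. -/
def fstEnd (e : squareLattice.edgeSet) : ℤ × ℤ := (Quot.out e.1).1

/-- The other endpoint of an edge. -/
def sndEnd (e : squareLattice.edgeSet) : ℤ × ℤ := (Quot.out e.1).2

theorem mk_ends (e : squareLattice.edgeSet) : s(fstEnd e, sndEnd e) = e.1 := Quot.out_eq e.1

theorem adj_ends (e : squareLattice.edgeSet) : squareLattice.Adj (fstEnd e) (sndEnd e) := by
  rw [← SimpleGraph.mem_edgeSet, mk_ends]
  exact e.2

theorem mem_edgesIn {Λ : Finset (ℤ × ℤ)} {e : squareLattice.edgeSet} :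
    e ∈ edgesIn Λ ↔ fstEnd e ∈ Λ ∧ sndEnd e ∈ Λ := by
  simp only [edgesIn, Finset.mem_subtype]
  rw [← mk_ends, Finset.mk_mem_sym2_iff]

/-- The product of the spins at the endpoints of an edge. -/
def edgeChar (Λ : Finset (ℤ × ℤ)) (e : squareLattice.edgeSet) : (Λ → ℤˣ) →* ℝ :=
  spin Λ (fstEnd e) * spin Λ (sndEnd e)

theorem adj_cases {x y : ℤ × ℤ} (h : squareLattice.Adj x y) :
    y = (x.1 + 1, x.2) ∨ x = (y.1 + 1, y.2) ∨ y = (x.1, x.2 + 1) ∨ x = (y.1, y.2 + 1) := by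
  change |x.1 - y.1| + |x.2 - y.2| = 1 at h
  simp only [Prod.ext_iff]
  rcases abs_cases (x.1 - y.1) with h1 | h1 <;> rcases abs_cases (x.2 - y.2) with h2 | h2 <;> omega

/-- The lower left endpoint of an edge between adjacent sites, with its direction. -/
def base (x y : ℤ × ℤ) : ℤ × ℤ × Bool := (min x.1 y.1, min x.2 y.2, decide (x.1 = y.1))

/-- The upper or right endpoint of an edge given by its lower left endpoint and its direction. -/
def latticeEnd (b : ℤ × ℤ × Bool) : ℤ × ℤ := if b.2.2 then (b.1, b.2.1 + 1) else (b.1 + 1, b.2.1)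

theorem eq_base {x y : ℤ × ℤ} (h : squareLattice.Adj x y) :
    (x = ((base x y).1, (base x y).2.1) ∧ y = latticeEnd (base x y)) ∨
      (y = ((base x y).1, (base x y).2.1) ∧ x = latticeEnd (base x y)) := by
  rcases adj_cases h with h | h | h | h
  · left; rw [h]; simp [base, latticeEnd]
  · right; rw [h]; simp [base, latticeEnd]
  · left; rw [h]; simp [base, latticeEnd]
  · right; rw [h]; simp [base, latticeEnd]

theorem mk_eq_of_base_eq {x y x' y' : ℤ × ℤ} (h : squareLattice.Adj x y)
    (h' : squareLattice.Adj x' y') (hb : base x y = base x' y') : s(x, y) = s(x', y') := by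
  have key : ∀ {x y : ℤ × ℤ}, squareLattice.Adj x y →
      s(x, y) = s(((base x y).1, (base x y).2.1), latticeEnd (base x y)) := by
    intro x y h
    rcases eq_base h with h | h
    · exact Sym2.eq_iff.2 (Or.inl h)
    · exact Sym2.eq_iff.2 (Or.inr h.symm)
  rw [key h, key h', hb]

/-- The site of the cylinder below a site of the lattice. -/
def wrap (L : ℕ) (x : ℤ × ℤ) : ZMod L × ℤ := (x.1, x.2)

open Classical in
/-- The configuration on `Λ` obtained by pulling back a configuration on the cylinder. -/
def pullback (Λ : Finset (ℤ × ℤ)) (L m : ℕ) [NeZero L] (D : ℤ × ℤ → ℤ × ℤ) :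
    (cylSites L m → ℤˣ) →* (Λ → ℤˣ) :=
  MonoidHom.mk' (fun σ z => if h : wrap L (D z) ∈ cylSites L m then σ ⟨_, h⟩ else 1) fun σ τ => by
    funext z
    simp only [Pi.mul_apply]
    split_ifs <;> simp

theorem spin_pullback {Λ : Finset (ℤ × ℤ)} {L m : ℕ} [NeZero L] (D : ℤ × ℤ → ℤ × ℤ) {z : ℤ × ℤ}
    (hz : z ∈ Λ) (σ : cylSites L m → ℤˣ) :
    spin Λ z (pullback Λ L m D σ) = spin (cylSites L m) (wrap L (D z)) σ := by
  rw [spin_of_mem hz]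
  by_cases h : wrap L (D z) ∈ cylSites L m
  · rw [spin_of_mem h]; simp [pullback, h]
  · rw [spin_of_notMem h]; simp [pullback, h]

/-- The free two-point function between the pinned part and the top of a region that embeds in a
cylinder of height `m`. -/
theorem free_correlation_le {Λ : Finset (ℤ × ℤ)} {m : ℕ} (hm : 1 ≤ m) {t : ℝ} (ht0 : 0 ≤ t)
    (ht1 : t < 1) (F : Finset squareLattice.edgeSet) {y u : ℤ × ℤ} (D : ℤ × ℤ → ℤ × ℤ)
    (hD : Function.Injective D)
    (hadj : ∀ x z, squareLattice.Adj x z → squareLattice.Adj (D x) (D z)) (c : ℤ)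
    (hF : ∀ e ∈ F, ∀ z, z = fstEnd e ∨ z = sndEnd e →
      z ∈ Λ ∧ (D z).2 ≤ m ∧ c ≤ (D z).1 ∧ (D z).1 ≤ c + 2 * m)
    (hu : D u = (0, (m : ℤ))) (huΛ : u ∈ Λ) (hy : (D y).2 = 0) :
    ∑ σ, spin Λ y σ * spin Λ u σ * ∏ e ∈ F, (1 + t * edgeChar Λ e σ) ≤
      (t * (1 + t) / (1 - t)) ^ m * ∑ σ, ∏ e ∈ F, (1 + t * edgeChar Λ e σ) := by
  classical
  -- A box of radius `m` has `2m + 1` columns, so no two of its edges are identified by wrapping.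
  let L := 2 * m + 1
  let Φ := pullback Λ L m D
  let f : squareLattice.edgeSet → ZMod L × ℤ × Bool := fun e =>
    (((base (D (fstEnd e)) (D (sndEnd e))).1 : ZMod L), (base (D (fstEnd e)) (D (sndEnd e))).2)
  have hΦ : ∀ z ∈ Λ, ∀ σ, spin Λ z (Φ σ) = spin (cylSites L m) (wrap L (D z)) σ :=
    fun z hz σ => spin_pullback D hz σ
  have hchar : ∀ e ∈ F, ∀ σ, edgeChar Λ e (Φ σ) = cylChar L m (f e) σ := by
    intro e he σ
    have hA := hadj _ _ (adj_ends e)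
    have hend : ∀ b : ℤ × ℤ × Bool, wrap L (latticeEnd b) = cylEnd ((b.1 : ZMod L), b.2) := by
      intro b
      unfold latticeEnd cylEnd
      split_ifs <;> simp [wrap]
    rw [edgeChar, MonoidHom.mul_apply, hΦ _ (hF e he _ (Or.inl rfl)).1,
      hΦ _ (hF e he _ (Or.inr rfl)).1, cylChar, MonoidHom.mul_apply, ← hend]
    rcases eq_base hA with ⟨h1, h2⟩ | ⟨h1, h2⟩
    · rw [← h2]
      conv_lhs => rw [h1]
      rfl
    · rw [← h2, mul_comm]
      conv_lhs => rw [h1]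
      rfl
  have hcomp := correlation_le Φ (spin Λ y * spin Λ u) (fun σ => ∏ e ∈ F, (1 + t * edgeChar Λ e σ))
    (fun σ => ∏ e ∈ cylEdges L m, (1 + t * cylChar L m e σ))
    (posType_prod_mul_prod Φ F (edgeChar Λ) (cylEdges L m) (cylChar L m) f ht0 ht1.le
      (fun e he _ => hchar e he) ?_ ?_)
  · have hcyl := cylinder_magnetization_le (L := L) (m := m) (by omega) ht0 ht1
    have hpull : ∀ σ, (spin Λ y * spin Λ u) (Φ σ) = spin (cylSites L m) (0, (m : ℤ)) σ := by
      intro σ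
      rw [MonoidHom.mul_apply, hΦ u huΛ, hu]
      have : spin Λ y (Φ σ) = 1 := by
        by_cases hyΛ : y ∈ Λ
        · rw [hΦ y hyΛ]
          exact spin_of_notMem (by simp [mem_cylSites, wrap, hy]) σ
        · exact spin_of_notMem hyΛ _
      rw [this, one_mul]
      simp [wrap]
    simp only [hpull] at hcomp
    have hZ : 0 < ∑ σ, ∏ e ∈ cylEdges L m, (1 + t * cylChar L m e σ) :=
      Finset.sum_pos (fun σ _ => Finset.prod_pos fun e _ => by
        nlinarith [neg_one_le_char (cylChar L m e) σ]) Finset.univ_nonempty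
    have hZF : 0 ≤ ∑ σ, ∏ e ∈ F, (1 + t * edgeChar Λ e σ) :=
      Finset.sum_nonneg fun σ _ => Finset.prod_nonneg fun e _ => by
        nlinarith [neg_one_le_char (edgeChar Λ e) σ]
    refine le_of_mul_le_mul_right ?_ hZ
    refine hcomp.trans ((mul_le_mul_of_nonneg_right hcyl hZF).trans_eq ?_)
    ring
  · intro e he hf σ
    rw [hchar e he]
    have h1 := hF e he _ (Or.inl rfl)
    have h2 := hF e he _ (Or.inr rfl)
    have hA := hadj _ _ (adj_ends e)
    rw [← hchar e he, edgeChar, MonoidHom.mul_apply, hΦ _ h1.1, hΦ _ h2.1]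
    -- An edge without image in the cylinder lies entirely in the pinned part.
    have hlow : (D (fstEnd e)).2 ≤ 0 ∧ (D (sndEnd e)).2 ≤ 0 := by
      rcases adj_cases hA with h | h | h | h
      · have : f e = (((D (fstEnd e)).1 : ZMod L), (D (fstEnd e)).2, false) := by
          simp [f, base, h]
        rw [this, mk_false_mem_cylEdges] at hf
        rw [h]; simp; omega
      · have : f e = (((D (sndEnd e)).1 : ZMod L), (D (sndEnd e)).2, false) := by
          simp [f, base, h]
        rw [this, mk_false_mem_cylEdges] at hf
        rw [h]; simp; omega
      · have : f e = (((D (fstEnd e)).1 : ZMod L), (D (fstEnd e)).2, true) := by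
          simp [f, base, h]
        rw [this, mk_true_mem_cylEdges] at hf
        rw [h] at h2 ⊢; simp at h2 ⊢; omega
      · have : f e = (((D (sndEnd e)).1 : ZMod L), (D (sndEnd e)).2, true) := by
          simp [f, base, h]
        rw [this, mk_true_mem_cylEdges] at hf
        rw [h] at h1 ⊢; simp at h1 ⊢; omega
    rw [spin_of_notMem, spin_of_notMem, one_mul]
    · simp only [mem_cylSites, wrap]; omega
    · simp only [mem_cylSites, wrap]; omega
  · intro e he e' he' _ hff
    have h1 := hF e he _ (Or.inl rfl)
    have h2 := hF e he _ (Or.inr rfl)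
    have h1' := hF e' he' _ (Or.inl rfl)
    have h2' := hF e' he' _ (Or.inr rfl)
    have hb : base (D (fstEnd e)) (D (sndEnd e)) = base (D (fstEnd e')) (D (sndEnd e')) := by
      refine Prod.ext ?_ (congrArg Prod.snd hff :)
      have hz : (((base (D (fstEnd e)) (D (sndEnd e))).1 : ℤ) : ZMod L)
        = (base (D (fstEnd e')) (D (sndEnd e'))).1 := congrArg Prod.fst hff
      have hdvd := (ZMod.intCast_eq_intCast_iff_dvd_sub _ _ _).1 hz
      have habs : |(base (D (fstEnd e')) (D (sndEnd e'))).1 - (base (D (fstEnd e)) (D (sndEnd e))).1|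
          < ((L : ℕ) : ℤ) := by
        have hL : ((L : ℕ) : ℤ) = 2 * m + 1 := by simp [L]
        rw [hL]
        simp only [base]
        rw [abs_lt]
        omega
      have := Int.eq_zero_of_abs_lt_dvd hdvd habs
      omega
    have hs := mk_eq_of_base_eq (hadj _ _ (adj_ends e)) (hadj _ _ (adj_ends e')) hb
    rw [← Sym2.map_mk, ← Sym2.map_mk] at hs
    have := Sym2.map.injective hD hs
    rw [mk_ends, mk_ends] at this
    exact Subtype.ext this

end FK

end

noncomputable section

namespace FK

/-! ### The Ising model with a boundary condition -/

open Classical in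
/-- The constraint that the spins agree on the classes of a boundary condition, up to a factor. -/
def bcWeight (Λ : Finset (ℤ × ℤ)) (ξ : BoundaryCondition Λ) (σ : Λ → ℤˣ) : ℝ :=
  ∏ q : boundary Λ × boundary Λ with ξ q.1 q.2, (1 + 1 * (spin Λ q.1.1 * spin Λ q.2.1) σ)

/-- The weight of a spin configuration. -/
def isingWeight (t : ℝ) (Λ : Finset (ℤ × ℤ)) (ξ : BoundaryCondition Λ) (σ : Λ → ℤˣ) : ℝ :=
  (∏ e ∈ edgesIn Λ, (1 + t * edgeChar Λ e σ)) * bcWeight Λ ξ σ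

/-- The unnormalized two-point function. -/
def twoPoint (t : ℝ) (Λ : Finset (ℤ × ℤ)) (ξ : BoundaryCondition Λ) (x y : ℤ × ℤ) : ℝ :=
  ∑ σ, spin Λ x σ * spin Λ y σ * isingWeight t Λ ξ σ

/-- The partition function of the Ising model. -/
def isingPartition (t : ℝ) (Λ : Finset (ℤ × ℤ)) (ξ : BoundaryCondition Λ) : ℝ :=
  ∑ σ, isingWeight t Λ ξ σ

section

variable {t : ℝ} {Λ : Finset (ℤ × ℤ)} {ξ : BoundaryCondition Λ}

theorem bcWeight_posType : PosType (bcWeight Λ ξ) :=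
  PosType.prod _ fun _ _ => PosType.one_add zero_le_one _

theorem isingWeight_posType (ht : 0 ≤ t) : PosType (isingWeight t Λ ξ) :=
  (PosType.prod _ fun _ _ => PosType.one_add ht _).mul bcWeight_posType

theorem isingWeight_nonneg (ht0 : 0 ≤ t) (ht1 : t ≤ 1) (σ : Λ → ℤˣ) : 0 ≤ isingWeight t Λ ξ σ :=
  mul_nonneg
    (Finset.prod_nonneg fun e _ => by nlinarith [neg_one_le_char (edgeChar Λ e) σ])
    (Finset.prod_nonneg fun q _ => by
      nlinarith [neg_one_le_char (spin Λ q.1.1 * spin Λ q.2.1) σ])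

theorem twoPoint_nonneg (ht : 0 ≤ t) (x y : ℤ × ℤ) : 0 ≤ twoPoint t Λ ξ x y :=
  ((isingWeight_posType ht).char_mul (spin Λ x * spin Λ y)).sum_nonneg

theorem twoPoint_le (ht0 : 0 ≤ t) (ht1 : t ≤ 1) (x y : ℤ × ℤ) :
    twoPoint t Λ ξ x y ≤ isingPartition t Λ ξ :=
  Finset.sum_le_sum fun σ _ => mul_le_of_le_one_left (isingWeight_nonneg ht0 ht1 σ)
    (char_le_one (spin Λ x * spin Λ y) σ)

theorem isingPartition_pos (ht0 : 0 ≤ t) (ht1 : t ≤ 1) : 0 < isingPartition t Λ ξ := by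
  refine Finset.sum_pos' (fun σ _ => isingWeight_nonneg ht0 ht1 σ) ⟨1, Finset.mem_univ _, ?_⟩
  refine mul_pos (Finset.prod_pos fun e _ => ?_) (Finset.prod_pos fun q _ => ?_)
  · rw [map_one]; linarith
  · rw [map_one]; norm_num

theorem notMem_boundary {z : ℤ × ℤ}
    (h : ∀ x, squareLattice.Adj z x → x ∈ Λ) : z ∉ boundary Λ := by
  classical
  intro hz
  have hcard := (Finset.mem_filter.1 hz).2
  have hsub : ({(z.1 + 1, z.2), (z.1 - 1, z.2), (z.1, z.2 + 1), (z.1, z.2 - 1)} : Finset (ℤ × ℤ)) ⊆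
      Λ.filter fun y => squareLattice.Adj z y := by
    intro x hx
    have hadj : squareLattice.Adj z x := by
      change |z.1 - x.1| + |z.2 - x.2| = 1
      simp only [Finset.mem_insert, Finset.mem_singleton] at hx
      rcases hx with rfl | rfl | rfl | rfl <;> simp
    exact Finset.mem_filter.2 ⟨h x hadj, hadj⟩
  have h4 : ({(z.1 + 1, z.2), (z.1 - 1, z.2), (z.1, z.2 + 1), (z.1, z.2 - 1)} :
      Finset (ℤ × ℤ)).card = 4 := by
    rw [Finset.card_insert_of_notMem, Finset.card_insert_of_notMem, Finset.card_insert_of_notMem,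
      Finset.card_singleton] <;> simp <;> omega
  have := Finset.card_le_card hsub
  rw [h4] at this
  have h5 : (Λ.filter fun y => squareLattice.Adj z y).card < 4 := by convert hcard
  omega

open Classical in
/-- The boundary of the box of radius `m` centred at `y`. -/
def sphere (y : ℤ × ℤ) (m : ℕ) : Finset (ℤ × ℤ) :=
  (Finset.Icc (y.1 - m) (y.1 + m) ×ˢ Finset.Icc (y.2 - m) (y.2 + m)).filter fun u =>
    |u.1 - y.1| = m ∨ |u.2 - y.2| = m

theorem mem_sphere {y u : ℤ × ℤ} {m : ℕ} : u ∈ sphere y m ↔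
    (|u.1 - y.1| ≤ m ∧ |u.2 - y.2| ≤ m) ∧ (|u.1 - y.1| = m ∨ |u.2 - y.2| = m) := by
  simp only [sphere, Finset.mem_filter, Finset.mem_product, Finset.mem_Icc, abs_le]
  refine and_congr_left fun _ => ?_
  omega

theorem card_sphere_le (y : ℤ × ℤ) (m : ℕ) : (sphere y m).card ≤ (2 * m + 1) ^ 2 := by
  refine (Finset.card_filter_le _ _).trans ?_
  rw [Finset.card_product, Int.card_Icc, Int.card_Icc, sq]
  refine Nat.mul_le_mul ?_ ?_ <;> omega

theorem adj_abs_le {x y : ℤ × ℤ} (h : squareLattice.Adj x y) :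
    |x.1 - y.1| ≤ 1 ∧ |x.2 - y.2| ≤ 1 := by
  change |x.1 - y.1| + |x.2 - y.2| = 1 at h
  have h1 := abs_nonneg (x.1 - y.1)
  have h2 := abs_nonneg (x.2 - y.2)
  omega

/-- The two-point function from `y` is bounded by its values on a sphere around `y`. -/
theorem twoPoint_le_sum_sphere (ht0 : 0 ≤ t) (ht1 : t < 1) {m : ℕ} (hm : 1 ≤ m) {x y : ℤ × ℤ}
    (hy : ∀ z : ℤ × ℤ, |z.1 - y.1| ≤ m → |z.2 - y.2| ≤ m → z ∈ Λ)
    (hx : (m : ℤ) ≤ |x.1 - y.1| ∨ (m : ℤ) ≤ |x.2 - y.2|) :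
    twoPoint t Λ ξ y x ≤
      (t * (1 + t) / (1 - t)) ^ m * ∑ u ∈ sphere y m, twoPoint t Λ ξ u x := by
  classical
  set I : Set (ℤ × ℤ) := {z | |z.1 - y.1| < m ∧ |z.2 - y.2| < m} with hI
  set F := (edgesIn Λ).filter fun e => fstEnd e ∈ I ∨ sndEnd e ∈ I with hF
  set v : (Λ → ℤˣ) → ℝ := fun σ =>
    (∏ e ∈ (edgesIn Λ).filter (fun e => ¬ (fstEnd e ∈ I ∨ sndEnd e ∈ I)),
      (1 + t * edgeChar Λ e σ)) * bcWeight Λ ξ σ with hv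
  have hw : ∀ σ, isingWeight t Λ ξ σ = (∏ e ∈ F, (1 + t * edgeChar Λ e σ)) * v σ := by
    intro σ
    rw [isingWeight, hv, ← mul_assoc, hF, Finset.prod_filter_mul_prod_filter_not]
  have hnear : ∀ e, (fstEnd e ∈ I ∨ sndEnd e ∈ I) → ∀ z, z = fstEnd e ∨ z = sndEnd e →
      |z.1 - y.1| ≤ m ∧ |z.2 - y.2| ≤ m := by
    intro e he z hz
    have hadj := adj_abs_le (adj_ends e)
    simp only [hI, Set.mem_ofPred_eq, abs_lt, abs_le] at he hadj ⊢
    rcases hz with rfl | rfl <;> omega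
  have hIΛ : ∀ z ∈ I, z ∈ Λ := fun z hz => hy z hz.1.le hz.2.le
  -- Interior sites have all their neighbours in `Λ`, so flips in `I` do not affect the boundary
  -- condition.
  have hbdry : ∀ z ∈ boundary Λ, z ∉ I := by
    intro z hz hzI
    refine notMem_boundary (fun w hw => ?_) hz
    have hadj := adj_abs_le hw
    simp only [hI, Set.mem_ofPred_eq, abs_lt, abs_le] at hzI hadj
    apply hy <;> rw [abs_le] <;> omega
  have hD : ∀ z : ℤ × ℤ, |z.1 - y.1| ≤ m ∧ |z.2 - y.2| ≤ m → z ∈ I ∨ z ∈ sphere y m := by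
    intro z hz
    rw [mem_sphere]
    simp only [hI, Set.mem_ofPred_eq]
    omega
  have hSL := simon_lieb (spin Λ) F fstEnd sndEnd ht0 ht1.le (v := v)
    ((PosType.prod _ fun e _ => PosType.one_add ht0 (edgeChar Λ e)).mul bcWeight_posType) I
    (sphere y m) (o := y) (x := x) (by simp [hI]; omega) (fun h => by
      simp only [hI, Set.mem_ofPred_eq] at h; omega)
    (fun e _ h => hD _ (hnear e (Or.inl h) _ (Or.inr rfl)))
    (fun e _ h => hD _ (hnear e (Or.inr h) _ (Or.inl rfl))) ?_
  · change (∑ σ, spin Λ y σ * spin Λ x σ * ((∏ e ∈ F, (1 + t * edgeChar Λ e σ)) * v σ)) *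
      ∑ σ, ∏ e ∈ F, (1 + t * edgeChar Λ e σ) ≤ ∑ u ∈ sphere y m,
        (∑ σ, spin Λ y σ * spin Λ u σ * ∏ e ∈ F, (1 + t * edgeChar Λ e σ)) *
        ∑ σ, spin Λ u σ * spin Λ x σ * ((∏ e ∈ F, (1 + t * edgeChar Λ e σ)) * v σ) at hSL
    simp only [← hw] at hSL
    have hZ : 0 < ∑ σ, ∏ e ∈ F, (1 + t * edgeChar Λ e σ) :=
      Finset.sum_pos (fun σ _ => Finset.prod_pos fun e _ => by
        nlinarith [neg_one_le_char (edgeChar Λ e) σ]) Finset.univ_nonempty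
    refine le_of_mul_le_mul_right (hSL.trans ?_) hZ
    rw [mul_assoc, Finset.sum_mul, Finset.mul_sum]
    refine Finset.sum_le_sum fun u hu => ?_
    have hcorr : ∑ σ, spin Λ y σ * spin Λ u σ * ∏ e ∈ F, (1 + t * edgeChar Λ e σ) ≤
        (t * (1 + t) / (1 - t)) ^ m * ∑ σ, ∏ e ∈ F, (1 + t * edgeChar Λ e σ) := by
      obtain ⟨hu1, hu2⟩ := mem_sphere.1 hu
      have huΛ : u ∈ Λ := hy u hu1.1 hu1.2
      have hFe : ∀ e ∈ F, ∀ z, z = fstEnd e ∨ z = sndEnd e →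
          z ∈ Λ ∧ (-m ≤ z.1 - y.1 ∧ z.1 - y.1 ≤ m) ∧ (-m ≤ z.2 - y.2 ∧ z.2 - y.2 ≤ m) := by
        intro e he z hz
        have := hnear e (Finset.mem_filter.1 he).2 z hz
        exact ⟨hy z this.1 this.2, abs_le.1 this.1, abs_le.1 this.2⟩
      have hcase : u.2 - y.2 = m ∨ y.2 - u.2 = m ∨ u.1 - y.1 = m ∨ y.1 - u.1 = m := by
        rcases hu2 with h | h
        · rcases abs_cases (u.1 - y.1) with h' | h' <;> omega
        · rcases abs_cases (u.2 - y.2) with h' | h' <;> omega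
      -- One symmetry of the lattice for each side of the sphere, bringing `u` to `(0, m)` and `y`
      -- to height `0`.
      rcases hcase with h | h | h | h
      · refine free_correlation_le hm ht0 ht1 F (fun z => (z.1 - u.1, z.2 - y.2)) ?_ ?_
          (y.1 - m - u.1) ?_ ?_ huΛ ?_
        · intro a b hab; simp only [Prod.mk.injEq] at hab; ext <;> omega
        · intro a b hab
          simpa [squareLattice] using hab
        · intro e he z hz
          have := hFe e he z hz
          refine ⟨this.1, ?_⟩; dsimp only; omega
        · ext <;> simp [h]
        · simp
      · refine free_correlation_le hm ht0 ht1 F (fun z => (z.1 - u.1, y.2 - z.2)) ?_ ?_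
          (y.1 - m - u.1) ?_ ?_ huΛ ?_
        · intro a b hab; simp only [Prod.mk.injEq] at hab; ext <;> omega
        · intro a b hab
          simpa [squareLattice, abs_sub_comm b.2] using hab
        · intro e he z hz
          have := hFe e he z hz
          refine ⟨this.1, ?_⟩; dsimp only; omega
        · ext <;> simp [h]
        · simp
      · refine free_correlation_le hm ht0 ht1 F (fun z => (z.2 - u.2, z.1 - y.1)) ?_ ?_
          (y.2 - m - u.2) ?_ ?_ huΛ ?_
        · intro a b hab; simp only [Prod.mk.injEq] at hab; ext <;> omega
        · intro a b hab
          simpa [squareLattice, add_comm] using hab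
        · intro e he z hz
          have := hFe e he z hz
          refine ⟨this.1, ?_⟩; dsimp only; omega
        · ext <;> simp [h]
        · simp
      · refine free_correlation_le hm ht0 ht1 F (fun z => (z.2 - u.2, y.1 - z.1)) ?_ ?_
          (y.2 - m - u.2) ?_ ?_ huΛ ?_
        · intro a b hab; simp only [Prod.mk.injEq] at hab; ext <;> omega
        · intro a b hab
          simpa [squareLattice, add_comm, abs_sub_comm b.1] using hab
        · intro e he z hz
          have := hFe e he z hz
          refine ⟨this.1, ?_⟩; dsimp only; omega
        · ext <;> simp [h]
        · simp
    refine (mul_le_mul_of_nonneg_right hcorr (twoPoint_nonneg ht0 u x)).trans_eq ?_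
    ring
  · intro C hC
    obtain ⟨g, hg1, hg2⟩ := exists_spin_eq_neg_one Λ C
    refine ⟨g, fun z hz => hg1 z (hIΛ z (hC hz)) hz, hg2, fun σ => ?_⟩
    simp only [hv, bcWeight]
    congr 1
    · refine Finset.prod_congr rfl fun e he => ?_
      have hne := (Finset.mem_filter.1 he).2
      rw [not_or] at hne
      have : edgeChar Λ e g = 1 := by
        rw [edgeChar, MonoidHom.mul_apply, hg2 _ fun h => hne.1 (hC h),
          hg2 _ fun h => hne.2 (hC h), one_mul]
      rw [map_mul, this, one_mul]
    · refine Finset.prod_congr rfl fun q _ => ?_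
      have : (spin Λ q.1.1 * spin Λ q.2.1) g = 1 := by
        rw [MonoidHom.mul_apply, hg2 _ fun h => hbdry _ q.1.2 (hC h),
          hg2 _ fun h => hbdry _ q.2.2 (hC h), one_mul]
      rw [map_mul, this, one_mul]

/-- Every coupling, including the infinite ones of the boundary condition, is paired with its own
replica. Through `correlation_le`, restricting the spins to the image of `h` then increases
correlations. -/
theorem isingWeight_mul_posType (ht0 : 0 ≤ t) (ht1 : t ≤ 1) {G : Type*} [CommGroup G] [Finite G]
    (h : G →* (Λ → ℤˣ)) (τ : Λ → ℤˣ) :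
    PosType fun x => isingWeight t Λ ξ (h x) * isingWeight t Λ ξ (h x * τ) := by
  have key : ∀ {s : ℝ}, 0 ≤ s → s ≤ 1 → ∀ χ : (Λ → ℤˣ) →* ℝ,
      PosType fun x => (1 + s * χ (h x)) * (1 + s * χ (h x * τ)) := by
    intro s hs0 hs1 χ
    simp only [map_mul]
    exact PosType.one_add_mul_one_add hs0 hs1 (χ.comp h) (abs_char χ τ).le
  have h1 := PosType.prod (edgesIn Λ) fun e _ => key ht0 ht1 (edgeChar Λ e)
  classical
  have h2 := PosType.prod (Finset.univ.filter fun q : boundary Λ × boundary Λ => ξ q.1 q.2)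
    fun q _ => key zero_le_one le_rfl (spin Λ q.1.1 * spin Λ q.2.1)
  convert h1.mul h2 using 2 with x
  rw [Finset.prod_mul_distrib, Finset.prod_mul_distrib, isingWeight, isingWeight, bcWeight, bcWeight]
  ring

theorem card_incident_le (y : ℤ × ℤ) (F : Finset squareLattice.edgeSet)
    (hF : ∀ e ∈ F, fstEnd e = y ∨ sndEnd e = y) : F.card ≤ 4 := by
  classical
  have hle : F.card ≤ (({(y.1 + 1, y.2), (y.1 - 1, y.2), (y.1, y.2 + 1), (y.1, y.2 - 1)} :
      Finset (ℤ × ℤ)).image fun z => s(y, z)).card := by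
    refine Finset.card_le_card_of_injOn Subtype.val (fun e he => ?_) Subtype.val_injective.injOn
    have hadj := adj_cases (adj_ends e)
    have key : ∃ z, e.1 = s(y, z) ∧
        (z = (y.1 + 1, y.2) ∨ y = (z.1 + 1, z.2) ∨ z = (y.1, y.2 + 1) ∨ y = (z.1, z.2 + 1)) := by
      rcases hF e he with h | h
      · exact ⟨sndEnd e, by rw [← mk_ends, h], by rw [h] at hadj; exact hadj⟩
      · refine ⟨fstEnd e, by rw [← mk_ends, h, Sym2.eq_swap], ?_⟩
        rw [h] at hadj
        tauto
    obtain ⟨z, hz, h⟩ := key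
    rw [Finset.mem_coe, Finset.mem_image]
    refine ⟨z, ?_, hz.symm⟩
    simp only [Finset.mem_insert, Finset.mem_singleton]
    simp only [Prod.ext_iff] at h ⊢
    omega
  exact hle.trans (Finset.card_image_le.trans Finset.card_le_four)

/-- Finite energy: the two-point function stays away from one. -/
theorem twoPoint_le_of_ne (ht0 : 0 ≤ t) (ht1 : t < 1) {x y : ℤ × ℤ} (hxy : x ≠ y)
    (hy : y ∈ Λ) (hyb : y ∉ boundary Λ) :
    twoPoint t Λ ξ y x * (1 + ((1 - t) / (1 + t)) ^ 4) ≤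
      (1 - ((1 - t) / (1 + t)) ^ 4) * isingPartition t Λ ξ := by
  classical
  set ρ := (1 - t) / (1 + t) with hρ
  have hρ0 : 0 ≤ ρ := div_nonneg (by linarith) (by linarith)
  have hρ1 : ρ ≤ 1 := by rw [hρ, div_le_one (by linarith)]; linarith
  have hρt : ρ * (1 + t) = 1 - t := by rw [hρ]; field_simp
  -- Pin every spin except the one at `y`; only two weights then remain to be compared.
  let h : ℤˣ →* (Λ → ℤˣ) := MonoidHom.mulSingle (fun _ => ℤˣ) ⟨y, hy⟩
  have hsy : ∀ s, spin Λ y (h s) = ((s : ℤˣ) : ℤ) := by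
    intro s
    rw [spin_of_mem hy]
    simp [h]
  have hsz : ∀ z, z ≠ y → ∀ s, spin Λ z (h s) = 1 := by
    intro z hz s
    by_cases hzΛ : z ∈ Λ
    · rw [spin_of_mem hzΛ]
      have : (⟨z, hzΛ⟩ : Λ) ≠ ⟨y, hy⟩ := fun h => hz (congrArg Subtype.val h)
      simp [h, this]
    · exact spin_of_notMem hzΛ _
  have hcomp := correlation_le h (spin Λ y * spin Λ x) (isingWeight t Λ ξ)
    (fun s => isingWeight t Λ ξ (h s)) (isingWeight_mul_posType ht0 ht1.le h)
  have huniv : (Finset.univ : Finset ℤˣ) = {1, -1} := by decide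
  have hne : (1 : ℤˣ) ∉ ({-1} : Finset ℤˣ) := by decide
  rw [huniv, Finset.sum_insert hne, Finset.sum_singleton, Finset.sum_insert hne,
    Finset.sum_singleton] at hcomp
  simp only [MonoidHom.mul_apply, hsy, hsz x hxy] at hcomp
  change twoPoint t Λ ξ y x * _ ≤ _ * isingPartition t Λ ξ at hcomp
  set w₁ := isingWeight t Λ ξ (h 1) with hw₁
  set w₂ := isingWeight t Λ ξ (h (-1)) with hw₂
  have hw₁pos : 0 < w₁ := by
    rw [hw₁, map_one]
    refine mul_pos (Finset.prod_pos fun e _ => ?_) (Finset.prod_pos fun q _ => ?_)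
    · rw [map_one]; linarith
    · rw [map_one]; norm_num
  -- Flipping the spin at `y` changes at most four edge factors, each by a ratio at least `ρ`.
  have hw : ρ ^ 4 * w₁ ≤ w₂ := by
    have hbc : bcWeight Λ ξ (h (-1)) = bcWeight Λ ξ (h 1) := by
      refine Finset.prod_congr rfl fun q _ => ?_
      have h1 : q.1.1 ≠ y := fun h => hyb (h ▸ q.1.2)
      have h2 : q.2.1 ≠ y := fun h => hyb (h ▸ q.2.2)
      simp only [MonoidHom.mul_apply, hsz _ h1, hsz _ h2]
    have hbc0 : 0 ≤ bcWeight Λ ξ (h 1) := Finset.prod_nonneg fun q _ => by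
      nlinarith [neg_one_le_char (spin Λ q.1.1 * spin Λ q.2.1) (h 1)]
    rw [hw₁, hw₂, isingWeight, isingWeight, hbc, ← mul_assoc]
    refine mul_le_mul_of_nonneg_right ?_ hbc0
    simp only [map_one]
    have hle : ∏ e ∈ edgesIn Λ, ((if fstEnd e = y ∨ sndEnd e = y then ρ else 1) * (1 + t * 1)) ≤
        ∏ e ∈ edgesIn Λ, (1 + t * edgeChar Λ e (h (-1))) := by
      refine Finset.prod_le_prod (fun e _ => ?_) fun e _ => ?_
      · split_ifs <;> positivity
      · split_ifs with hc
        · nlinarith [neg_one_le_char (edgeChar Λ e) (h (-1))]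
        · rw [not_or] at hc
          rw [edgeChar, MonoidHom.mul_apply, hsz _ hc.1, hsz _ hc.2]
          linarith
    refine le_trans ?_ hle
    rw [Finset.prod_mul_distrib]
    refine mul_le_mul_of_nonneg_right ?_ (Finset.prod_nonneg fun _ _ => by linarith)
    rw [Finset.prod_ite, Finset.prod_const, Finset.prod_const_one, mul_one]
    exact pow_le_pow_of_le_one hρ0 hρ1
      (card_incident_le y _ fun e he => (Finset.mem_filter.1 he).2)
  have hT := twoPoint_nonneg (Λ := Λ) (ξ := ξ) ht0 y x
  have hZ := isingPartition_pos (Λ := Λ) (ξ := ξ) ht0 ht1.le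
  refine le_of_mul_le_mul_right ?_ hw₁pos
  have a1 : twoPoint t Λ ξ y x * (ρ ^ 4 * w₁) ≤ twoPoint t Λ ξ y x * w₂ :=
    mul_le_mul_of_nonneg_left hw hT
  have a2 : (ρ ^ 4 * w₁) * isingPartition t Λ ξ ≤ w₂ * isingPartition t Λ ξ :=
    mul_le_mul_of_nonneg_right hw hZ.le
  norm_num at hcomp
  linarith

end

end FK

end

noncomputable section

namespace FK

/-! ### The Edwards–Sokal coupling -/

section

variable {Λ : Finset (ℤ × ℤ)} {ξ : BoundaryCondition Λ} {S : Finset squareLattice.edgeSet}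

open Classical in
/-- The number of pairs of boundary sites in the same class. -/
def numPairs (Λ : Finset (ℤ × ℤ)) (ξ : BoundaryCondition Λ) : ℕ :=
  (Finset.univ.filter fun q : boundary Λ × boundary Λ => ξ q.1 q.2).card

theorem mul_spin_eq_one {x y : ℤ × ℤ} (hx : x ∈ Λ) (hy : y ∈ Λ) {σ : Λ → ℤˣ}
    (h : σ ⟨x, hx⟩ = σ ⟨y, hy⟩) : (spin Λ x * spin Λ y) σ = 1 := by
  have : spin Λ x σ = spin Λ y σ := by rw [spin_of_mem hx, spin_of_mem hy, h]
  rw [MonoidHom.mul_apply, this, char_mul_self]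

theorem mul_spin_eq_neg_one {x y : ℤ × ℤ} (hx : x ∈ Λ) (hy : y ∈ Λ) {σ : Λ → ℤˣ}
    (h : σ ⟨x, hx⟩ ≠ σ ⟨y, hy⟩) : (spin Λ x * spin Λ y) σ = -1 := by
  rw [MonoidHom.mul_apply, spin_of_mem hx, spin_of_mem hy]
  rcases Int.units_eq_one_or (σ ⟨x, hx⟩) with h1 | h1 <;>
  rcases Int.units_eq_one_or (σ ⟨y, hy⟩) with h2 | h2 <;> simp_all

theorem openGraph_adj {x y : ℤ × ℤ} : (openGraph (ofOpenEdges S)).Adj x y ↔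
    ∃ h : s(x, y) ∈ squareLattice.edgeSet, ⟨s(x, y), h⟩ ∈ S := by
  simp only [openGraph, SimpleGraph.fromEdgeSet_adj, ofOpenEdges, decide_eq_true_eq]
  constructor
  · rintro ⟨⟨h, h'⟩, -⟩
    exact ⟨h, h'⟩
  · rintro ⟨h, h'⟩
    exact ⟨⟨h, h'⟩, ((SimpleGraph.mem_edgeSet _).1 h).ne⟩

theorem mem_boundary_subset {x : ℤ × ℤ} (hx : x ∈ boundary Λ) : x ∈ Λ := (Finset.mem_filter.1 hx).1

/-- The factors of an open edge set and of the boundary condition multiply to the indicator of the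
spin configurations that are constant on clusters. -/
theorem prod_eq_indicator (hS : S ⊆ edgesIn Λ) (σ : Λ → ℤˣ)
    [Decidable (∀ x y, (wiredGraph Λ ξ S).Adj x y → σ x = σ y)] :
    (∏ e ∈ S, ((1 + edgeChar Λ e σ) / 2)) * (bcWeight Λ ξ σ / 2 ^ numPairs Λ ξ)
      = if ∀ x y, (wiredGraph Λ ξ S).Adj x y → σ x = σ y then 1 else 0 := by
  classical
  split_ifs with hc
  · have h1 : ∏ e ∈ S, ((1 + edgeChar Λ e σ) / 2) = 1 := by
      refine Finset.prod_eq_one fun e he => ?_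
      obtain ⟨ha, hb⟩ := mem_edgesIn.1 (hS he)
      have hadj : (wiredGraph Λ ξ S).Adj ⟨_, ha⟩ ⟨_, hb⟩ :=
        Or.inl (openGraph_adj.2 ⟨by rw [mk_ends]; exact e.2, by
          have : (⟨s(fstEnd e, sndEnd e), by rw [mk_ends]; exact e.2⟩ : squareLattice.edgeSet) = e :=
            Subtype.ext (mk_ends e)
          rw [this]; exact he⟩)
      rw [edgeChar, mul_spin_eq_one ha hb (hc _ _ hadj)]
      norm_num
    have h2 : bcWeight Λ ξ σ = 2 ^ numPairs Λ ξ := by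
      rw [bcWeight, numPairs, ← Finset.prod_const]
      refine Finset.prod_congr rfl fun q hq => ?_
      have hq' := (Finset.mem_filter.1 hq).2
      have hs : σ ⟨q.1.1, mem_boundary_subset q.1.2⟩ = σ ⟨q.2.1, mem_boundary_subset q.2.2⟩ := by
        by_cases hne : q.1.1 = q.2.1
        · simp only [hne]
        · refine hc _ _ (Or.inr ?_)
          rw [SimpleGraph.fromRel_adj]
          exact ⟨fun h => hne (congrArg (fun z : Λ => z.1) h), Or.inl ⟨q.1.2, q.2.2, hq'⟩⟩
      rw [mul_spin_eq_one _ _ hs]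
      norm_num
    rw [h1, h2, one_mul, div_self (by positivity)]
  · push Not at hc
    obtain ⟨x, y, hadj, hne⟩ := hc
    rcases hadj with hadj | hadj
    · obtain ⟨he, heS⟩ := openGraph_adj.1 hadj
      have hzero : 1 + edgeChar Λ ⟨s(x.1, y.1), he⟩ σ = 0 := by
        have hm := mk_ends ⟨s(x.1, y.1), he⟩
        rw [edgeChar]
        rcases Sym2.eq_iff.1 hm with ⟨h1, h2⟩ | ⟨h1, h2⟩
        · rw [h1, h2, mul_spin_eq_neg_one x.2 y.2 hne]; norm_num
        · rw [h1, h2, mul_spin_eq_neg_one y.2 x.2 hne.symm]; norm_num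
      rw [Finset.prod_eq_zero heS (by rw [hzero, zero_div]), zero_mul]
    · rw [SimpleGraph.fromRel_adj] at hadj
      have key : ∀ x y : Λ, σ x ≠ σ y →
          (∃ (hx : x.1 ∈ boundary Λ) (hy : y.1 ∈ boundary Λ), ξ ⟨x.1, hx⟩ ⟨y.1, hy⟩) →
          bcWeight Λ ξ σ = 0 := by
        rintro x y hne ⟨hx, hy, hxy⟩
        refine Finset.prod_eq_zero (i := (⟨x.1, hx⟩, ⟨y.1, hy⟩))
          (Finset.mem_filter.2 ⟨Finset.mem_univ _, hxy⟩) ?_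
        rw [mul_spin_eq_neg_one x.2 y.2 hne]
        norm_num
      have : bcWeight Λ ξ σ = 0 := by
        rcases hadj.2 with h | h
        · exact key x y hne h
        · exact key y x hne.symm h
      rw [this, zero_div, mul_zero]

theorem eq_of_reachable {σ : Λ → ℤˣ} (h : ∀ x y, (wiredGraph Λ ξ S).Adj x y → σ x = σ y) {x y : Λ}
    (hxy : (wiredGraph Λ ξ S).Reachable x y) : σ x = σ y := by
  obtain ⟨w⟩ := hxy
  induction w with
  | nil => rfl
  | cons hadj _ ih => exact (h _ _ hadj).trans ih

/-- Spin configurations constant on clusters are counted by one free sign per cluster. -/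
theorem two_pow_numClusters (hS : S ⊆ edgesIn Λ) : (2 : ℝ) ^ numClusters Λ ξ S =
    ∑ σ, (∏ e ∈ S, ((1 + edgeChar Λ e σ) / 2)) * (bcWeight Λ ξ σ / 2 ^ numPairs Λ ξ) := by
  classical
  simp only [prod_eq_indicator hS]
  rw [Finset.sum_boole]
  let f : ((wiredGraph Λ ξ S).ConnectedComponent → ℤˣ) → (Λ → ℤˣ) := fun φ x =>
    φ ((wiredGraph Λ ξ S).connectedComponentMk x)
  have hf : Function.Injective f := by
    intro φ ψ h
    funext c
    induction c using SimpleGraph.ConnectedComponent.ind with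
    | h v => exact congrFun h v
  have : Fintype (wiredGraph Λ ξ S).ConnectedComponent := Fintype.ofFinite _
  have himg : Finset.univ.filter
      (fun σ : Λ → ℤˣ => ∀ x y, (wiredGraph Λ ξ S).Adj x y → σ x = σ y) = Finset.univ.image f := by
    ext σ
    simp only [Finset.mem_filter, Finset.mem_univ, true_and, Finset.mem_image]
    constructor
    · intro h
      refine ⟨SimpleGraph.ConnectedComponent.lift σ fun x y w _ => eq_of_reachable h ⟨w⟩, ?_⟩
      funext x
      simp [f]
    · rintro ⟨φ, rfl⟩ x y hadj
      simp only [f]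
      rw [SimpleGraph.ConnectedComponent.eq.2 hadj.reachable]
  rw [himg, Finset.card_image_of_injective _ hf, Finset.card_univ, Fintype.card_fun,
    Fintype.card_units_int, numClusters, Nat.card_eq_fintype_card]
  push_cast
  rfl

/-- Summing the spin representation over the open edges gives the Ising model. -/
theorem sum_powerset_eq {p : ℝ} (hp : p < 2) (f : (Λ → ℤˣ) → ℝ) :
    ∑ S ∈ (edgesIn Λ).powerset, p ^ S.card * (1 - p) ^ ((edgesIn Λ).card - S.card) *
        ∑ σ, f σ * ((∏ e ∈ S, ((1 + edgeChar Λ e σ) / 2)) * (bcWeight Λ ξ σ / 2 ^ numPairs Λ ξ))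
      = (1 - p / 2) ^ (edgesIn Λ).card / 2 ^ numPairs Λ ξ *
        ∑ σ, f σ * isingWeight (p / (2 - p)) Λ ξ σ := by
  classical
  simp only [Finset.mul_sum]
  rw [Finset.sum_comm]
  refine Finset.sum_congr rfl fun σ _ => ?_
  have h1 : ∀ S ∈ (edgesIn Λ).powerset, p ^ S.card * (1 - p) ^ ((edgesIn Λ).card - S.card) *
      (f σ * ((∏ e ∈ S, ((1 + edgeChar Λ e σ) / 2)) * (bcWeight Λ ξ σ / 2 ^ numPairs Λ ξ)))
      = f σ * (bcWeight Λ ξ σ / 2 ^ numPairs Λ ξ) *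
        ((∏ e ∈ S, (p * ((1 + edgeChar Λ e σ) / 2))) * ∏ e ∈ edgesIn Λ \ S, (1 - p)) := by
    intro S hS
    rw [Finset.prod_mul_distrib, Finset.prod_const, Finset.prod_const,
      Finset.card_sdiff_of_subset (Finset.mem_powerset.1 hS)]
    ring
  rw [Finset.sum_congr rfl h1, ← Finset.mul_sum, ← Finset.prod_add]
  have h2 : ∀ e ∈ edgesIn Λ, p * ((1 + edgeChar Λ e σ) / 2) + (1 - p)
      = (1 - p / 2) * (1 + p / (2 - p) * edgeChar Λ e σ) := by
    intro e _
    have : (2 - p) ≠ 0 := by linarith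
    field_simp
    ring
  rw [Finset.prod_congr rfl h2, Finset.prod_mul_distrib, Finset.prod_const, isingWeight]
  ring

theorem partitionFunction_eq {p : ℝ} (hp : p < 2) : partitionFunction p 2 Λ ξ =
    (1 - p / 2) ^ (edgesIn Λ).card / 2 ^ numPairs Λ ξ * isingPartition (p / (2 - p)) Λ ξ := by
  have := sum_powerset_eq (Λ := Λ) (ξ := ξ) hp fun _ => 1
  simp only [one_mul] at this
  rw [isingPartition, ← this, partitionFunction]
  refine Finset.sum_congr rfl fun S hS => ?_
  rw [weight, two_pow_numClusters (Finset.mem_powerset.1 hS)]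

theorem wiredGraph_reachable (hS : S ⊆ edgesIn Λ) {x y : ℤ × ℤ} (hx : x ∈ Λ) (hy : y ∈ Λ)
    (h : Connected (ofOpenEdges S) x y) : (wiredGraph Λ ξ S).Reachable ⟨x, hx⟩ ⟨y, hy⟩ := by
  obtain ⟨w⟩ := h
  induction w with
  | nil => rfl
  | @cons u v _ hadj _ ih =>
    obtain ⟨he, heS⟩ := openGraph_adj.1 hadj
    have hv : v ∈ Λ := by
      have h1 := mem_edgesIn.1 (hS heS)
      rcases Sym2.eq_iff.1 (mk_ends ⟨s(u, v), he⟩) with ⟨h2, h3⟩ | ⟨h2, h3⟩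
      · exact h3 ▸ h1.2
      · exact h2 ▸ h1.1
    have : (wiredGraph Λ ξ S).Adj ⟨u, hx⟩ ⟨v, hv⟩ := Or.inl hadj
    exact this.reachable.trans (ih hv hy)

/-- The connection probabilities are bounded by the Ising two-point function. -/
theorem finiteVolume_le {p : ℝ} (hp0 : 0 ≤ p) (hp1 : p ≤ 1) {x y : ℤ × ℤ} (hx : x ∈ Λ) (hy : y ∈ Λ)
    {A : Set Config} (hA : MeasurableSet A) (hAc : ∀ ω ∈ A, Connected ω x y) :
    finiteVolume p 2 Λ ξ A ≤ ENNReal.ofReal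
      (twoPoint (p / (2 - p)) Λ ξ x y / isingPartition (p / (2 - p)) Λ ξ) := by
  classical
  have ht0 : 0 ≤ p / (2 - p) := div_nonneg hp0 (by linarith)
  have ht1 : p / (2 - p) ≤ 1 := by rw [div_le_one (by linarith)]; linarith
  have hZ := isingPartition_pos (Λ := Λ) (ξ := ξ) ht0 ht1
  have hK : 0 < (1 - p / 2) ^ (edgesIn Λ).card / 2 ^ numPairs Λ ξ :=
    div_pos (pow_pos (by linarith) _) (by positivity)
  have hPF : 0 < partitionFunction p 2 Λ ξ := by
    rw [partitionFunction_eq (by linarith)]; exact mul_pos hK hZ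
  have hwt : ∀ S, 0 ≤ weight p 2 Λ ξ S := fun S =>
    mul_nonneg (mul_nonneg (pow_nonneg hp0 _) (pow_nonneg (by linarith) _)) (by positivity)
  have hval : finiteVolume p 2 Λ ξ A = ENNReal.ofReal (∑ S ∈ (edgesIn Λ).powerset,
      (if ofOpenEdges S ∈ A then weight p 2 Λ ξ S else 0) / partitionFunction p 2 Λ ξ) := by
    rw [finiteVolume, Measure.finsetSum_apply, ENNReal.ofReal_sum_of_nonneg]
    · refine Finset.sum_congr rfl fun S _ => ?_
      rw [Measure.smul_apply, Measure.dirac_apply' _ hA, smul_eq_mul]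
      by_cases h : ofOpenEdges S ∈ A <;> simp [h]
    · intro S _
      split_ifs
      · exact div_nonneg (hwt S) hPF.le
      · simp
  rw [hval]
  refine ENNReal.ofReal_le_ofReal ?_
  rw [← Finset.sum_div, div_le_div_iff₀ hPF hZ, partitionFunction_eq (by linarith), ← mul_assoc]
  refine mul_le_mul_of_nonneg_right ?_ hZ.le
  have hsum := sum_powerset_eq (Λ := Λ) (ξ := ξ) (p := p) (by linarith)
    fun σ => spin Λ x σ * spin Λ y σ
  rw [twoPoint, mul_comm, ← hsum]
  refine Finset.sum_le_sum fun S hS => ?_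
  have hS' := Finset.mem_powerset.1 hS
  have hcoef : 0 ≤ p ^ S.card * (1 - p) ^ ((edgesIn Λ).card - S.card) :=
    mul_nonneg (pow_nonneg hp0 _) (pow_nonneg (by linarith) _)
  split_ifs with hSA
  · rw [weight, two_pow_numClusters hS']
    refine mul_le_mul_of_nonneg_left (Finset.sum_le_sum fun σ _ => ?_) hcoef
    rw [prod_eq_indicator hS']
    split_ifs with hc
    · have := mul_spin_eq_one hx hy (eq_of_reachable hc (wiredGraph_reachable hS' hx hy (hAc _ hSA)))
      rw [MonoidHom.mul_apply] at this
      rw [this, one_mul]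
    · simp
  -- Configurations outside `A` may still correlate `x` and `y`, for instance through the wiring,
  -- but their contribution is nonnegative.
  · refine mul_nonneg hcoef ?_
    have hpos : PosType fun σ => ∏ e ∈ S, ((1 + edgeChar Λ e σ) / 2) :=
      PosType.prod S fun e _ => by
        convert (PosType.one_add zero_le_one (edgeChar Λ e)).smul (1 / 2) (by norm_num) using 2
        ring
    have hbc : PosType fun σ => bcWeight Λ ξ σ / 2 ^ numPairs Λ ξ := by
      convert (bcWeight_posType (Λ := Λ) (ξ := ξ)).smul (1 / 2 ^ numPairs Λ ξ) (by positivity)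
        using 2
      ring
    exact ((hpos.mul hbc).char_mul (spin Λ x * spin Λ y)).sum_nonneg

end

end FK

end

noncomputable section

namespace FK

/-! ### Exponential decay -/

theorem mem_box {N : ℕ} {z : ℤ × ℤ} : z ∈ box N ↔ |z.1| ≤ N ∧ |z.2| ≤ N := by
  simp [box, Finset.mem_product, abs_le]

theorem twoPoint_le_pow {t α : ℝ} (ht0 : 0 ≤ t) (ht1 : t < 1) {m : ℕ} (hm : 1 ≤ m)
    (hα : (t * (1 + t) / (1 - t)) ^ m * (2 * m + 1) ^ 2 ≤ α) {N : ℕ}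
    (ξ : BoundaryCondition (box N)) {x : ℤ × ℤ} (k : ℕ) :
    ∀ y : ℤ × ℤ, ((k * m : ℤ) ≤ |x.1 - y.1| ∨ (k * m : ℤ) ≤ |x.2 - y.2|) →
      |y.1| + k * m ≤ N → |y.2| + k * m ≤ N →
      twoPoint t (box N) ξ y x ≤ α ^ k * isingPartition t (box N) ξ := by
  have hr : 0 ≤ (t * (1 + t) / (1 - t)) ^ m :=
    pow_nonneg (div_nonneg (by positivity) (by linarith)) _
  have hα0 : 0 ≤ α := le_trans (by positivity) hα
  have hZ := isingPartition_pos (Λ := box N) (ξ := ξ) ht0 ht1.le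
  induction k with
  | zero =>
    intro y _ _ _
    rw [pow_zero, one_mul]
    exact twoPoint_le ht0 ht1.le y x
  | succ k ih =>
    intro y hxy hy1 hy2
    have hk : (0 : ℤ) ≤ k * m := by positivity
    push_cast at hxy hy1 hy2
    rw [add_mul, one_mul] at hxy hy1 hy2
    refine (twoPoint_le_sum_sphere ht0 ht1 hm (fun z h1 h2 => ?_) (by omega)).trans ?_
    · rw [mem_box]
      have h3 := abs_add_le (z.1 - y.1) y.1
      have h4 := abs_add_le (z.2 - y.2) y.2
      rw [sub_add_cancel] at h3 h4
      omega
    · have hterm : ∀ u ∈ sphere y m,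
          twoPoint t (box N) ξ u x ≤ α ^ k * isingPartition t (box N) ξ := by
        intro u hu
        have hu1 := (mem_sphere.1 hu).1
        have h3 := abs_add_le (u.1 - y.1) y.1
        have h4 := abs_add_le (u.2 - y.2) y.2
        have h5 := abs_add_le (x.1 - u.1) (u.1 - y.1)
        have h6 := abs_add_le (x.2 - u.2) (u.2 - y.2)
        rw [sub_add_cancel] at h3 h4
        rw [sub_add_sub_cancel] at h5 h6
        exact ih u (by omega) (by omega) (by omega)
      have hsum := Finset.sum_le_card_nsmul _ _ _ hterm
      have hcard : ((sphere y m).card : ℝ) ≤ (2 * m + 1) ^ 2 := by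
        exact_mod_cast card_sphere_le y m
      rw [nsmul_eq_mul] at hsum
      have hP : 0 ≤ α ^ k * isingPartition t (box N) ξ :=
        mul_nonneg (pow_nonneg hα0 k) hZ.le
      calc (t * (1 + t) / (1 - t)) ^ m * ∑ u ∈ sphere y m, twoPoint t (box N) ξ u x
          ≤ (t * (1 + t) / (1 - t)) ^ m *
            ((2 * m + 1) ^ 2 * (α ^ k * isingPartition t (box N) ξ)) :=
            mul_le_mul_of_nonneg_left
              (hsum.trans (mul_le_mul_of_nonneg_right hcard hP)) hr
        _ = ((t * (1 + t) / (1 - t)) ^ m * (2 * m + 1) ^ 2) *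
            (α ^ k * isingPartition t (box N) ξ) := by ring
        _ ≤ α * (α ^ k * isingPartition t (box N) ξ) := mul_le_mul_of_nonneg_right hα hP
        _ = α ^ (k + 1) * isingPartition t (box N) ξ := by ring

theorem exists_radius {r : ℝ} (hr0 : 0 ≤ r) (hr1 : r < 1) :
    ∃ m : ℕ, 1 ≤ m ∧ r ^ m * (2 * m + 1) ^ 2 ≤ 1 / 2 := by
  have h := tendsto_pow_const_mul_const_pow_of_abs_lt_one 2
    (show |r| < 1 by rwa [abs_of_nonneg hr0])
  -- `1/18` is `1/2` divided by `9`, since `(2m + 1)² ≤ 9m²` for `m ≥ 1`.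
  have h2 := h.eventually (eventually_lt_nhds (show (0 : ℝ) < 1 / 18 by norm_num))
  obtain ⟨m, hm, hm1⟩ := (h2.and (eventually_ge_atTop 1)).exists
  refine ⟨m, hm1, ?_⟩
  have hm1' : (1 : ℝ) ≤ m := by exact_mod_cast hm1
  have hrm : 0 ≤ r ^ m := pow_nonneg hr0 m
  have : (2 * (m : ℝ) + 1) ^ 2 ≤ 9 * (m : ℝ) ^ 2 := by nlinarith
  nlinarith [mul_le_mul_of_nonneg_left this hrm]

/-- Exponential decay of the two-point function, uniformly in the boundary condition. -/
theorem exists_twoPoint_le_exp {t : ℝ} (ht0 : 0 ≤ t) (ht1 : t < 1)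
    (hr : t * (1 + t) / (1 - t) < 1) :
    ∃ c : ℝ, 0 < c ∧ ∀ n N : ℕ, n < N → ∀ ξ : BoundaryCondition (box N),
      twoPoint t (box N) ξ (0, 0) (0, (n : ℤ)) ≤
        Real.exp (-c * n) * isingPartition t (box N) ξ := by
  obtain ⟨m, hm, hα⟩ := exists_radius (div_nonneg (by positivity) (by linarith)) hr
  set ρ := ((1 - t) / (1 + t)) ^ 4 with hρ
  have hρ0 : 0 < ρ := pow_pos (div_pos (by linarith) (by linarith)) _
  -- The first entry is the finite-energy bound, used for `0 < n < m`; the second is the gain of one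
  -- Simon–Lieb step.
  set a := max ((1 - ρ) / (1 + ρ)) (1 / 2) with ha
  have ha0 : 0 < a := lt_of_lt_of_le (by norm_num) (le_max_right _ _)
  have ha1 : a < 1 := max_lt (by rw [div_lt_one (by linarith)]; linarith) (by norm_num)
  have hlog : Real.log a < 0 := Real.log_neg ha0 ha1
  have hm0 : (0 : ℝ) < m := by exact_mod_cast hm
  have hexp : ∀ n k : ℕ, n ≤ 2 * m * k → a ^ k ≤ Real.exp (-(-Real.log a / (2 * m)) * n) := by
    intro n k hnk
    rw [← Real.exp_log (pow_pos ha0 k), Real.log_pow]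
    refine Real.exp_le_exp.2 ?_
    have h1 : (n : ℝ) ≤ 2 * m * k := by exact_mod_cast hnk
    have h2 : -(-Real.log a / (2 * m)) * n = Real.log a * (n / (2 * m)) := by ring
    have h3 : (n : ℝ) / (2 * m) ≤ k := by rw [div_le_iff₀ (by positivity)]; linarith
    rw [h2, mul_comm (k : ℝ)]
    exact mul_le_mul_of_nonpos_left h3 hlog.le
  refine ⟨-Real.log a / (2 * m), div_pos (by linarith) (by positivity), fun n N hnN ξ => ?_⟩
  have hZ := isingPartition_pos (Λ := box N) (ξ := ξ) ht0 ht1.le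
  rcases Nat.eq_zero_or_pos n with hn | hn
  · subst hn
    refine (twoPoint_le ht0 ht1.le _ _).trans_eq ?_
    simp
  rcases lt_or_ge n m with hnm | hnm
  · have h0 : ((0, 0) : ℤ × ℤ) ∈ box N := by simp [mem_box]
    have hb : ((0, 0) : ℤ × ℤ) ∉ boundary (box N) := by
      refine notMem_boundary fun z hz => ?_
      have := adj_abs_le hz
      simp only [zero_sub, abs_neg] at this
      rw [mem_box]
      omega
    have hne : ((0, (n : ℤ)) : ℤ × ℤ) ≠ (0, 0) := by
      intro h
      simp only [Prod.mk.injEq] at h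
      omega
    have h1 := twoPoint_le_of_ne (ξ := ξ) ht0 ht1 hne h0 hb
    rw [← hρ, ← le_div_iff₀ (by linarith), mul_div_right_comm] at h1
    refine h1.trans (mul_le_mul_of_nonneg_right ((le_max_left _ (1 / 2)).trans ?_) hZ.le)
    have := hexp n 1 (by omega)
    rwa [pow_one] at this
  · have hdm := Nat.div_mul_le_self n m
    have h1 := twoPoint_le_pow ht0 ht1 hm hα ξ (x := (0, (n : ℤ))) (n / m) (0, 0)
      (Or.inr (by simp; exact_mod_cast hdm))
      (by simp only [abs_zero, zero_add]; exact_mod_cast hdm.trans hnN.le)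
      (by simp only [abs_zero, zero_add]; exact_mod_cast hdm.trans hnN.le)
    refine h1.trans (mul_le_mul_of_nonneg_right ?_ hZ.le)
    refine (pow_le_pow_left₀ (by norm_num) (le_max_right ((1 - ρ) / (1 + ρ)) (1 / 2)) _).trans
      (hexp n _ ?_)
    -- For `n ≥ m`, rounding `n / m` down loses at most a factor `2`; hence the `2 * m` in the rate.
    have h2 : 1 ≤ n / m := (Nat.one_le_div_iff hm).2 hnm
    have h3 := Nat.lt_mul_div_succ n hm
    nlinarith

/-! ### Passage to infinite volume -/

open Classical in
/-- The configuration in which the edges outside `E` are closed. -/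
def extendClosed (E : Finset squareLattice.edgeSet) (η : E → Bool) : Config :=
  fun e => if h : e ∈ E then η ⟨e, h⟩ else false

theorem openGraph_extendClosed_adj {E : Finset squareLattice.edgeSet} {ω : Config} {x y : ℤ × ℤ} :
    (openGraph (extendClosed E (E.restrict ω))).Adj x y ↔
      ∃ h : s(x, y) ∈ squareLattice.edgeSet, ω ⟨s(x, y), h⟩ = true ∧ ⟨s(x, y), h⟩ ∈ E := by
  simp only [openGraph, SimpleGraph.fromEdgeSet_adj, extendClosed]
  constructor
  · rintro ⟨⟨h, h'⟩, -⟩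
    refine ⟨h, ?_⟩
    split_ifs at h' with hE
    exact ⟨h', hE⟩
  · rintro ⟨h, h', hE⟩
    refine ⟨⟨h, ?_⟩, ((SimpleGraph.mem_edgeSet _).1 h).ne⟩
    simpa [hE] using h'

theorem edgesIn_box_mono {M M' : ℕ} (h : M ≤ M') : edgesIn (box M) ⊆ edgesIn (box M') := by
  intro e he
  rw [mem_edgesIn] at he ⊢
  simp only [mem_box] at he ⊢
  omega

/-- The sites `x` and `y` are joined by open edges of `box M`. -/
def ConnectedIn (M : ℕ) (x y : ℤ × ℤ) (ω : Config) : Prop :=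
  Connected (extendClosed (edgesIn (box M)) ((edgesIn (box M)).restrict ω)) x y

theorem ConnectedIn.mono {M M' : ℕ} (h : M ≤ M') {x y : ℤ × ℤ} {ω : Config}
    (hc : ConnectedIn M x y ω) : ConnectedIn M' x y ω := by
  refine SimpleGraph.Reachable.mono ?_ hc
  intro a b hab
  rw [openGraph_extendClosed_adj] at hab ⊢
  obtain ⟨h1, h2, h3⟩ := hab
  exact ⟨h1, h2, edgesIn_box_mono h h3⟩

theorem ConnectedIn.connected {M : ℕ} {x y : ℤ × ℤ} {ω : Config}
    (hc : ConnectedIn M x y ω) : Connected ω x y := by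
  refine SimpleGraph.Reachable.mono ?_ hc
  intro a b hab
  rw [openGraph_extendClosed_adj] at hab
  obtain ⟨h1, h2, -⟩ := hab
  exact (SimpleGraph.fromEdgeSet_adj _).2 ⟨⟨h1, h2⟩, ((SimpleGraph.mem_edgeSet _).1 h1).ne⟩

theorem Connected.exists_connectedIn {x y : ℤ × ℤ} {ω : Config} (hc : Connected ω x y) :
    ∃ M, ConnectedIn M x y ω := by
  obtain ⟨w⟩ := hc
  induction w with
  | nil => exact ⟨0, SimpleGraph.Reachable.refl _⟩
  | @cons u v z hadj _ ih =>
    obtain ⟨M, hM⟩ := ih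
    obtain ⟨⟨he, hω⟩, -⟩ := (SimpleGraph.fromEdgeSet_adj _).1 hadj
    let e : squareLattice.edgeSet := ⟨s(u, v), he⟩
    let K := (|(fstEnd e).1| + |(fstEnd e).2| + |(sndEnd e).1| + |(sndEnd e).2|).toNat
    refine ⟨max M K, SimpleGraph.Reachable.trans ?_ (hM.mono (le_max_left _ _))⟩
    refine SimpleGraph.Adj.reachable (openGraph_extendClosed_adj.2 ⟨he, hω, ?_⟩)
    refine edgesIn_box_mono (le_max_right M K) (mem_edgesIn.2 ⟨mem_box.2 ?_, mem_box.2 ?_⟩)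
    all_goals
      have h1 := abs_nonneg (fstEnd e).1
      have h2 := abs_nonneg (fstEnd e).2
      have h3 := abs_nonneg (sndEnd e).1
      have h4 := abs_nonneg (sndEnd e).2
      simp only [K, e] at h1 h2 h3 h4 ⊢
      omega

/-- Connection inside a fixed box is a local event, so the uniform finite-volume bound passes to the
limit; continuity from below then removes the box. -/
theorem IsInfiniteVolume.measure_connected_le {p : ℝ} (hp0 : 0 ≤ p) (hp1 : p ≤ 1)
    {φ : Measure Config} (hφ : IsInfiniteVolume p 2 φ) {x y : ℤ × ℤ} {b : ℝ} {N₀ : ℕ}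
    (hx : x ∈ box N₀) (hy : y ∈ box N₀)
    (hb : ∀ N, N₀ ≤ N → ∀ ξ : BoundaryCondition (box N),
      twoPoint (p / (2 - p)) (box N) ξ x y ≤ b * isingPartition (p / (2 - p)) (box N) ξ) :
    φ {ω | Connected ω x y} ≤ ENNReal.ofReal b := by
  obtain ⟨-, N, ξ, hN, hlim⟩ := hφ
  have ht0 : 0 ≤ p / (2 - p) := div_nonneg hp0 (by linarith)
  have ht1 : p / (2 - p) ≤ 1 := by rw [div_le_one (by linarith)]; linarith
  have hunion : {ω | Connected ω x y} = ⋃ M, {ω | ConnectedIn M x y ω} := by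
    ext ω
    simp only [Set.mem_iUnion]
    exact ⟨fun h => h.exists_connectedIn, fun ⟨M, h⟩ => h.connected⟩
  have hmono : Monotone fun M => {ω | ConnectedIn M x y ω} := fun M M' h ω hω => hω.mono h
  rw [hunion, hmono.measure_iUnion]
  refine iSup_le fun M => ?_
  let A : Set (edgesIn (box M) → Bool) := {η | Connected (extendClosed _ η) x y}
  have hcyl : {ω | ConnectedIn M x y ω} = cylinder (edgesIn (box M)) A := rfl
  have hmeas : MeasurableSet (cylinder (edgesIn (box M)) A) :=
    MeasurableSet.cylinder (α := fun _ : squareLattice.edgeSet => Bool) _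
      (Set.toFinite A).measurableSet
  rw [hcyl]
  refine le_of_tendsto (hlim (edgesIn (box M)) A) ?_
  filter_upwards [eventually_ge_atTop N₀] with k hk
  have hNk : N₀ ≤ N k := hk.trans hN.le_apply
  have hsub : ∀ z, z ∈ box N₀ → z ∈ box (N k) := by
    intro z hz
    rw [mem_box] at hz ⊢
    omega
  refine (finiteVolume_le hp0 hp1 (hsub x hx) (hsub y hy) hmeas ?_).trans
    (ENNReal.ofReal_le_ofReal ?_)
  · intro ω hω
    rw [← hcyl] at hω
    exact ConnectedIn.connected hω
  · rw [div_le_iff₀ (isingPartition_pos ht0 ht1)]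
    exact hb (N k) hNk (ξ k)

end FK

end

theorem mainTheorem6 (p : ℝ) (hp₀ : 0 ≤ p) (hp : p < √2 / (1 + √2)) :
    ∃ ξ : ℝ, 0 < ξ ∧
      ∀ φ : MeasureTheory.Measure FK.Config, FK.IsInfiniteVolume p 2 φ →
        ∀ n : ℕ, φ.real {ω | FK.Connected ω (0, 0) (0, (n : ℤ))} ≤ Real.exp (-ξ * n) := by
  have hs : √2 * √2 = 2 := Real.mul_self_sqrt (by norm_num)
  have hs0 : 0 < √2 := by positivity
  have hs2 : √2 < 2 := by nlinarith
  have hp2 : p < 2 - √2 := by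
    rw [lt_div_iff₀ (by linarith)] at hp
    nlinarith
  have hp1 : p ≤ 1 := by nlinarith
  have ht0 : 0 ≤ p / (2 - p) := div_nonneg hp₀ (by linarith)
  have hts : p / (2 - p) < √2 - 1 := by
    rw [div_lt_iff₀ (by linarith)]
    nlinarith
  have ht1 : p / (2 - p) < 1 := by linarith
  -- For `t < 1` the inequality reads `t² + 2t < 1`, that is `(t + 1)² < 2`.
  have hr : p / (2 - p) * (1 + p / (2 - p)) / (1 - p / (2 - p)) < 1 := by
    rw [div_lt_one (by linarith)]
    nlinarith
  obtain ⟨c, hc, hle⟩ := FK.exists_twoPoint_le_exp ht0 ht1 hr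
  refine ⟨c, hc, fun φ hφ n => ?_⟩
  refine ENNReal.toReal_le_of_le_ofReal (Real.exp_pos _).le
    (hφ.measure_connected_le hp₀ hp1 (N₀ := n + 1) ?_ ?_ fun N hN ξ => hle n N hN ξ)
  · simp [FK.mem_box]
    positivity
  · simp [FK.mem_box]
    positivity
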